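/- **Conventions.** Inputs are bit strings. An *interactive protocol* with a verifier $V$ and cooperating, computationally unbounded provers $P_1,\dots,P_{p(n)}$ runs on an input $x$ of length $n=|x|$ as follows. The provers speak first and then verifier and provers alternate; the provers speak $k(n)\ge 1$ times; each prover message has at most $\ell(n)\ge 1$ bits; provers do not communicate with each other; $V$ uses a uniformly random string $r$ of $\rho(n)$ bits. The numbers $p(n)\ge 1,k(n),\ell(n),\rho(n)$, the messages of $V$, and the final output of $V$ are computable in (deterministic) polynomial time; the former from $1^n$ to unary, the latter two from $x$, $r$ and the messages received. A strategy profile $s$ gives for each prover the next message as a function of the transcript that this prover has seen. In an *MRIP protocol* the output of $V$ is a rational payment $R\in[0,1]$. Write $u(s;x)=\mathbf E_r[R]$ for the expected payment; $s^*$ is *optimal* for $x$ if $u(s^*;x)=\max_s u(s;x)$. The *answer bit* is the first bit of the first message of $P_1$. The protocol is an MRIP protocol *for* $L$ if for every $x$ and every optimal $s^*$ the answer bit is $1$ if and only if $x\in L$. In an *MIP protocol* $V$ accepts or rejects. It is an MIP protocol for $L$ with completeness $c(n)$ and soundness $e(n)$ if for every $x\in L$ some strategy profile makes $V$ accept with probability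 at least $c(|x|)$, and for every $x\notin L$ every strategy profile makes $V$ accept with probability at most $e(|x|)$. **Theorem.** Let $(V,\vec P)$ be an MRIP protocol for a language $L$, and let $\gamma:\mathbb N\to\mathbb R$ be any function with $\gamma(n)>1$ for all $n$ and $\gamma(n)=O(n^k)$ for some $k$, such that for every $n$ $$\min_{x\in L,\,|x|=n} u(s^*;x)\;>\;\max_{y\notin L,\,|y|=n} u(s^*;y)+\frac1{\gamma(n)}$$ (that is, the inequality holds for all $x\in L$ and $y\notin L$ of length $n$, with $s^*$ optimal for the respective input; it is no condition if all or none of the strings of length $n$ are in $L$). Then $(V,\vec P)$ can be simulated by MIP protocols for $L$ with the same number of provers: 1. There is an MIP protocol for $L$ with $p(n)$ provers whose completeness $c(n)$ and soundness $e(n)$ satisfy $0\le e(n)$, $e(n)+\frac1{4\gamma(n)}<c(n)\le 1$ for all $n$. 2. Suppose that there is a rational threshold $\theta(n)$, computable from $1^n$ in polynomial time, with $u(s^*;x)\ge\theta(n)+\frac1{4\gamma(n)}$ for all $x\in L$ and $u(s^*;x)\le\theta(n)-\frac1{4\gamma(n)}$ for all $x\notin L$ of length $n$ (for instance, $\theta(n)=\min_{x\in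 L,|x|=n}u(s^*;x)-\frac1{2\gamma(n)}$, if each length has both members and non-members of $L$ and this number is rational and so computable). Then for every polynomial $q$ with coefficients in $\mathbb N$ there is an MIP protocol for $L$ with $p(n)$ provers, completeness at least $1-\frac1{q(n)+1}$ and soundness at most $\frac1{q(n)+1}$. 3. Without the assumption in 2, for every polynomial $q$ with coefficients in $\mathbb N$ there is an MIP protocol for $L$ with $p(n)$ provers, completeness at least $1-\frac1{q(n)+1}$ and soundness at most $\frac1{q(n)+1}$, whose polynomial-time verifier receives in addition an advice string of length $O(\log n)$ (more exactly, at most $C(\log_2 n+1)$ symbols for $n \ge 1$, with a constant $C$) that depends only on the input length $n$. -/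

import Mathlib

/-- Words are written over `{0, 1, #}`: `some b` is the bit `b`, and `none` is the separator `#`. -/
abbrev Letter : Type := Option Bool

namespace Machine

/-- Programs of a machine with finitely many stacks (registers, numbered by `ℕ`), each of which
holds a word over `{0, 1, #}`. Every elementary operation looks at or changes only the top symbol
of one stack. -/
inductive Prog : Type
  | skip : Prog
  /-- put the symbol `a` on the stack `r` -/
  | push (r : ℕ) (a : Letter) : Prog
  /-- remove the top symbol of the stack `r` (no effect on an empty stack) -/
  | pop (r : ℕ) : Prog
  | seq (P Q : Prog) : Prog
  /-- run `P` if the top symbol of the stack `r` is `a`, and `Q` otherwise -/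
  | ite (r : ℕ) (a : Letter) (P Q : Prog) : Prog
  /-- run `P` as long as the stack `r` is not empty -/
  | loop (r : ℕ) (P : Prog) : Prog

/-- The contents of all stacks; the head of the list is the top of the stack. -/
abbrev Store : Type := ℕ → List Letter

/-- `Runs P σ t τ`: started on the store `σ`, the program `P` halts after exactly `t` elementary
steps with the store `τ`. -/
inductive Runs : Prog → Store → ℕ → Store → Prop
  | skip (σ : Store) : Runs .skip σ 1 σ
  | push (r : ℕ) (a : Letter) (σ : Store) :
      Runs (.push r a) σ 1 (Function.update σ r (a :: σ r))
  | pop (r : ℕ) (σ : Store) :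
      Runs (.pop r) σ 1 (Function.update σ r (σ r).tail)
  | seq {P Q : Prog} {σ τ υ : Store} {t t' : ℕ} :
      Runs P σ t τ → Runs Q τ t' υ → Runs (.seq P Q) σ (t + t') υ
  | iteTrue {r : ℕ} {a : Letter} {P Q : Prog} {σ τ : Store} {t : ℕ} :
      (σ r).head? = some a → Runs P σ t τ → Runs (.ite r a P Q) σ (t + 1) τ
  | iteFalse {r : ℕ} {a : Letter} {P Q : Prog} {σ τ : Store} {t : ℕ} :
      (σ r).head? ≠ some a → Runs Q σ t τ → Runs (.ite r a P Q) σ (t + 1) τ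
  | loopDone {r : ℕ} {P : Prog} {σ : Store} :
      σ r = [] → Runs (.loop r P) σ 1 σ
  | loopStep {r : ℕ} {P : Prog} {σ τ υ : Store} {t t' : ℕ} :
      σ r ≠ [] → Runs P σ t τ → Runs (.loop r P) τ t' υ → Runs (.loop r P) σ (t + t' + 1) υ

/-- The initial store: the input words on the stacks `0, 1, 2, …`, all other stacks empty. -/
def initial (inputs : List (List Letter)) : Store := fun i => inputs.getD i []

/-- The function that sends `a`, given by the words `inp a`, to the word `out a` is computable in
time polynomial in the total length of the input words. The output is left on the stack `0`. -/
def PolyTimeComputable {α : Type} (inp : α → List (List Letter)) (out : α → List Letter) : Prop :=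
  ∃ (P : Prog) (b : Polynomial ℕ), ∀ a : α, ∃ (t : ℕ) (τ : Store),
    Runs P (initial (inp a)) t τ ∧ τ 0 = out a ∧ t ≤ b.eval ((inp a).map List.length).sum

/-- A bit string as a word. -/
def word (w : List Bool) : List Letter := w.map some

/-- A list of bit strings as a word: every string is followed by the separator. -/
def words (l : List (List Bool)) : List Letter := l.flatMap fun w => word w ++ [none]

/-- The number `n` in unary. -/
def unary (n : ℕ) : List Letter := List.replicate n (some true)

/-- A rational number: its sign, and the numerator and denominator in binary. -/
def encodeRat (q : ℚ) : List Letter := words [[decide (q < 0)], q.num.natAbs.bits, q.den.bits]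

/-- `f` is computable in polynomial time, with argument and value in unary. In particular `f` is
polynomially bounded. -/
def PolyTimeUnary (f : ℕ → ℕ) : Prop :=
  PolyTimeComputable (fun n : ℕ => [unary n]) (fun n => unary (f n))

end Machine

namespace InteractiveProof

open Machine

/-- What a verifier computes with: the input `x`, its coins, the messages received so far, and the
advice string for the input length (empty for an ordinary verifier). -/
def verifierInput (adv : ℕ → List Letter) (a : List Bool × List Bool × List (List Bool)) :
    List (List Letter) :=
  [word a.1, word a.2.1, words a.2.2, adv a.1.length]

/-- The ordinary, uniform case: no advice. -/
def noAdvice : ℕ → List Letter := fun _ => []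

/-- The verifier's side of the interaction in a multi-prover protocol, for inputs of length `n`:
there are `numProvers n` provers; the provers speak first, and then the verifier and the provers
alternate until the provers have spoken `numRounds n` times; a prover's message has at most
`msgLen n` bits; the verifier tosses `numCoins n` fair coins. All messages of the provers received
so far are listed in order (by round, and within a round by prover), and `next x r h` is the list of
the messages that the verifier then sends to the provers `0, 1, …`, when its input is `x`, its
coins are `r` and it has received `h`. The verifier's own earlier messages are functions of the same
data. -/
structure Protocol (adv : ℕ → List Letter) where
  numProvers : ℕ → ℕ
  numRounds : ℕ → ℕ
  msgLen : ℕ → ℕ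
  numCoins : ℕ → ℕ
  numProvers_pos : ∀ n, 0 < numProvers n
  numRounds_pos : ∀ n, 0 < numRounds n
  msgLen_pos : ∀ n, 0 < msgLen n
  numProvers_poly : PolyTimeUnary numProvers
  numRounds_poly : PolyTimeUnary numRounds
  msgLen_poly : PolyTimeUnary msgLen
  numCoins_poly : PolyTimeUnary numCoins
  next : List Bool → List Bool → List (List Bool) → List (List Bool)
  next_poly : PolyTimeComputable (verifierInput adv) (fun a => words (next a.1 a.2.1 a.2.2))

/-- A strategy profile: prover `i` maps the transcript it has seen, a list of pairs (message sent,
answer of the verifier to it), to its next message. The provers are computationally unbounded and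
do not see each other's messages. -/
abbrev Profile : Type := ℕ → List (List Bool × List Bool) → List Bool

namespace Protocol

variable {adv : ℕ → List Letter}

/-- The interaction on input `x` with coins `r` after the provers have spoken `j` times: the
messages the verifier has received, and what each prover has seen. Bits of a prover's message
beyond the permitted length are cut off. -/
def play (V : Protocol adv) (x r : List Bool) (s : Profile) :
    ℕ → List (List Bool) × (ℕ → List (List Bool × List Bool))
  | 0 => ([], fun _ => [])
  | j + 1 =>
    let seen := (V.play x r s j).2
    let msg : ℕ → List Bool := fun i => (s i (seen i)).take (V.msgLen x.length)
    let h := (V.play x r s j).1 ++ (List.range (V.numProvers x.length)).map msg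
    (h, fun i => seen i ++ [(msg i, (V.next x r h).getD i [])])

/-- All messages received by the verifier in the whole interaction. -/
def transcript (V : Protocol adv) (x r : List Bool) (s : Profile) : List (List Bool) :=
  (V.play x r s (V.numRounds x.length)).1

/-- The expectation of a quantity that depends on the verifier's coins, on inputs of length `n`. -/
noncomputable def coinAverage (V : Protocol adv) (n : ℕ) (f : List Bool → ℝ) : ℝ :=
  (∑ r : Fin (V.numCoins n) → Bool, f (List.ofFn r)) / 2 ^ V.numCoins n

/-- The answer bit: the first bit of the first message of the first prover. It is sent before the
verifier says anything, so that it does not depend on the coins. -/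
def answerBit (V : Protocol adv) (x : List Bool) (s : Profile) : Bool :=
  ((s 0 []).take (V.msgLen x.length)).headD false

end Protocol

/-- The verifier of a rational protocol: at the end it computes a payment in `[0, 1]`. -/
structure RationalVerifier extends Protocol noAdvice where
  payment : List Bool → List Bool → List (List Bool) → ℚ
  payment_nonneg : ∀ x r h, 0 ≤ payment x r h
  payment_le_one : ∀ x r h, payment x r h ≤ 1
  payment_poly : PolyTimeComputable (verifierInput noAdvice)
    (fun a => encodeRat (payment a.1 a.2.1 a.2.2))

namespace RationalVerifier

/-- The expected payment `u(s; x)`. -/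
noncomputable def expectedPayment (V : RationalVerifier) (x : List Bool) (s : Profile) : ℝ :=
  V.coinAverage x.length fun r => (V.payment x r (V.transcript x r s) : ℝ)

/-- The profile `s` maximizes the expected payment on input `x`. -/
def IsOptimal (V : RationalVerifier) (x : List Bool) (s : Profile) : Prop :=
  ∀ s' : Profile, V.expectedPayment x s' ≤ V.expectedPayment x s

/-- `V` is the verifier of a multi-prover rational interactive proof protocol for `L`: under every
optimal strategy profile the answer bit tells whether the input is in `L`. -/
def IsMRIP (V : RationalVerifier) (L : Set (List Bool)) : Prop :=
  ∀ (x : List Bool) (s : Profile), V.IsOptimal x s → (V.answerBit x s = true ↔ x ∈ L)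

end RationalVerifier

/-- The verifier of a classical protocol: at the end it accepts or rejects. -/
structure ClassicalVerifier (adv : ℕ → List Letter) extends Protocol adv where
  accepts : List Bool → List Bool → List (List Bool) → Bool
  accepts_poly : PolyTimeComputable (verifierInput adv)
    (fun a => word [accepts a.1 a.2.1 a.2.2])

namespace ClassicalVerifier

variable {adv : ℕ → List Letter}

/-- The probability that the verifier accepts. -/
noncomputable def acceptProb (M : ClassicalVerifier adv) (x : List Bool) (s : Profile) : ℝ :=
  M.coinAverage x.length fun r => if M.accepts x r (M.transcript x r s) = true then 1 else 0

/-- `M` is the verifier of a multi-prover interactive proof for `L` with completeness `c` and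
soundness `e`, both functions of the input length. -/
def IsMIP (M : ClassicalVerifier adv) (L : Set (List Bool)) (c e : ℕ → ℝ) : Prop :=
  (∀ x ∈ L, ∃ s : Profile, c x.length ≤ M.acceptProb x s) ∧
  (∀ x ∉ L, ∀ s : Profile, M.acceptProb x s ≤ e x.length)

end ClassicalVerifier

end InteractiveProof

/-!
The gap in the expected payments of a rational protocol is turned into a gap in acceptance
probabilities by tossing coins. Given the payment `R ∈ [0, 1]` and a threshold `t ∈ [0, 1]`, the
verifier `RationalVerifier.withThreshold` tosses one coin to decide whether to accept when an
event of probability `R` occurs or when an event of probability `t` does not occur. It thus accepts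
with probability `(u + 1 - t) / 2`, where `u` is the expected payment. An event of probability
`a / b` is simulated, up to an error of `2⁻ᵐ`, by `m` fair coins (`Machine.bernoulli`): each coin
sends `v = a / b` to `2 v` or `2 v - 1`, truncated, and `v` is a martingale that is soon absorbed
at `0` or `1`. Up to this error the acceptance probability is an increasing affine function of `u`,
so that provers who want to be accepted maximize the expected payment. The maximum is attained,
because on a given input there are only finitely many transcripts.

* With `t = 1 / 2` the acceptance probability is about `1 / 4 + u / 2`. The payment gap `1 / γ`
  becomes a gap of about `1 / (2 γ)`, and lengths on which the language is trivial cause no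
  trouble, as the probability lies between `1 / 4` and `3 / 4` and `γ > 1`
  (`exists_isMIP_of_gap`).
* If `t` separates the payments, then the acceptance probability is bounded away from `1 / 2`, on
  the right side, by an inverse polynomial. Such a protocol is repeated sequentially and decided
  by majority (`ClassicalVerifier.majority`). The provers may use in a run everything they saw in
  earlier runs, but, given the earlier coins, they still follow some strategy profile
  (`coinAvg_runAccepted`), so that the centred count of accepted runs is a supermartingale with
  bounded increments; its positive part has second moment at most `N`
  (`coinAvg_sq_posPart_sum_le`), and Chebyshev's inequality gives error `1 / (N d²)` for
  advantage `d` (`exists_amplified`).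
* Without a computable threshold, a fraction with polynomially bounded denominator near the middle
  of the payment gap is supplied as advice (`exists_threshold`).

It remains to see that these verifiers run in polynomial time on the stack machine. Programs are
composed by way of `Machine.Transforms`, which prescribes the final store completely, including
that all auxiliary stacks are empty. It is closed under composition, renaming of stacks, branching
and polynomially bounded loops. From this a small functional calculus `Machine.PolyComp` is derived,
with recursion on the letters of a word (`PolyComp.fold`) as its main principle, in which
arithmetic and the verifiers are written down as ordinary functions.
-/

namespace Machine

/-! ### Elementary facts about runs -/

theorem monotone_eval (b : Polynomial ℕ) : Monotone fun n => b.eval n := by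
  intro m n h
  simp only [Polynomial.eval_eq_sum_range]
  gcongr

/-- All stacks from number `K` on are empty. -/
def Below (K : ℕ) (σ : Store) : Prop := ∀ i, K ≤ i → σ i = []

theorem Below.mono {K K' : ℕ} {σ : Store} (h : Below K σ) (hK : K ≤ K') : Below K' σ :=
  fun i hi => h i (hK.trans hi)

/-- The total length of the first `K` stacks. -/
def size (K : ℕ) (σ : Store) : ℕ := ∑ i ∈ Finset.range K, (σ i).length

theorem size_mono {K K' : ℕ} (h : K ≤ K') (σ : Store) : size K σ ≤ size K' σ :=
  Finset.sum_le_sum_of_subset (Finset.range_mono h)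

theorem length_le_size {K i : ℕ} (h : i < K) (σ : Store) : (σ i).length ≤ size K σ :=
  Finset.single_le_sum (f := fun i => (σ i).length) (fun _ _ => Nat.zero_le _)
    (Finset.mem_range.2 h)

theorem size_update_le (K : ℕ) (σ : Store) (r : ℕ) (v : List Letter)
    (hv : v.length ≤ (σ r).length + 1) : size K (Function.update σ r v) ≤ size K σ + 1 := by
  have h : ∀ i ∈ Finset.range K,
      (Function.update σ r v i).length ≤ (σ i).length + if i = r then 1 else 0 := by
    intro i _
    by_cases hi : i = r
    · subst hi; simpa using hv
    · simp [hi]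
  refine (Finset.sum_le_sum h).trans ?_
  rw [Finset.sum_add_distrib, Finset.sum_ite_eq']
  unfold size
  split_ifs <;> omega

/-- A run of `t` steps lengthens the words in the store by at most `t` symbols. -/
theorem Runs.size_le {P : Prog} {σ τ : Store} {t : ℕ} (h : Runs P σ t τ) (K : ℕ) :
    size K τ ≤ size K σ + t := by
  induction h with
  | skip σ => omega
  | push r a σ => exact size_update_le _ _ _ _ (by simp)
  | pop r σ => exact size_update_le _ _ _ _ (by simp; omega)
  | seq _ _ h1 h2 => omega
  | iteTrue _ _ ih => omega
  | iteFalse _ _ ih => omega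
  | loopDone _ => omega
  | loopStep _ _ _ h1 h2 => omega

theorem Runs.cast {P : Prog} {σ τ τ' : Store} {t : ℕ} (h : Runs P σ t τ) (e : τ = τ') :
    Runs P σ t τ' := e ▸ h

/-- A number above all numbers of stacks that occur in a program. -/
def Prog.bound : Prog → ℕ
  | .skip => 0
  | .push r _ => r + 1
  | .pop r => r + 1
  | .seq P Q => max P.bound Q.bound
  | .ite r _ P Q => max (r + 1) (max P.bound Q.bound)
  | .loop r P => max (r + 1) P.bound

theorem Runs.eq_of_bound_le {P : Prog} {σ τ : Store} {t : ℕ} (h : Runs P σ t τ) :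
    ∀ i, P.bound ≤ i → τ i = σ i := by
  induction h with
  | skip σ => intro i _; rfl
  | push r a σ =>
    intro i hi
    simp only [Prog.bound] at hi
    exact Function.update_of_ne (by omega) _ _
  | pop r σ =>
    intro i hi
    simp only [Prog.bound] at hi
    exact Function.update_of_ne (by omega) _ _
  | seq _ _ h1 h2 =>
    intro i hi
    simp only [Prog.bound, max_le_iff] at hi
    rw [h2 i hi.2, h1 i hi.1]
  | iteTrue _ _ ih =>
    intro i hi
    simp only [Prog.bound, max_le_iff] at hi
    exact ih i hi.2.1
  | iteFalse _ _ ih =>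
    intro i hi
    simp only [Prog.bound, max_le_iff] at hi
    exact ih i hi.2.2
  | loopDone _ => intro i _; rfl
  | loopStep _ _ _ h1 h2 =>
    intro i hi
    rw [h2 i hi]
    simp only [Prog.bound, max_le_iff] at hi
    exact h1 i hi.2

/-- The program with all numbers of stacks increased by `k`. -/
def Prog.shift (k : ℕ) : Prog → Prog
  | .skip => .skip
  | .push r a => .push (k + r) a
  | .pop r => .pop (k + r)
  | .seq P Q => .seq (P.shift k) (Q.shift k)
  | .ite r a P Q => .ite (k + r) a (P.shift k) (Q.shift k)
  | .loop r P => .loop (k + r) (P.shift k)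

/-- The first `k` stacks of `L`, followed by the stacks of `σ`. -/
def glue (k : ℕ) (L σ : Store) : Store := fun i => if i < k then L i else σ (i - k)

@[simp] theorem glue_add (k : ℕ) (L σ : Store) (i : ℕ) : glue k L σ (k + i) = σ i := by
  simp [glue]

theorem glue_update (k : ℕ) (L σ : Store) (r : ℕ) (v : List Letter) :
    Function.update (glue k L σ) (k + r) v = glue k L (Function.update σ r v) := by
  funext i
  by_cases hi : i < k
  · have : i ≠ k + r := by omega
    simp [glue, hi, this]
  · obtain ⟨j, rfl⟩ := Nat.exists_eq_add_of_le (not_lt.1 hi)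
    by_cases hj : j = r
    · subst hj; simp
    · rw [Function.update_of_ne (by omega)]
      simp [hj]

theorem Runs.shift {P : Prog} {σ τ : Store} {t : ℕ} (h : Runs P σ t τ) (k : ℕ) (L : Store) :
    Runs (P.shift k) (glue k L σ) t (glue k L τ) := by
  induction h with
  | skip σ => exact .skip _
  | push r a σ => exact (Runs.push (k + r) a _).cast (by rw [glue_add, glue_update])
  | pop r σ => exact (Runs.pop (k + r) _).cast (by rw [glue_add, glue_update])
  | seq _ _ h1 h2 => exact .seq h1 h2
  | iteTrue hr _ ih => exact .iteTrue (by simpa using hr) ih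
  | iteFalse hr _ ih => exact .iteFalse (by simpa using hr) ih
  | loopDone hr => exact .loopDone (by simpa using hr)
  | loopStep hr _ _ h1 h2 => exact .loopStep (by simpa using hr) h1 h2

/-! ### Moving words between stacks -/

/-- Run the program that `f` assigns to the top symbol of the stack `r`. -/
def onTop (r : ℕ) (f : Letter → Prog) : Prog :=
  .ite r (some true) (f (some true)) (.ite r (some false) (f (some false)) (f none))

theorem runs_onTop {r : ℕ} {f : Letter → Prog} {σ τ : Store} {t : ℕ} {a : Letter}
    (ha : (σ r).head? = some a) (h : Runs (f a) σ t τ) :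
    ∃ t' ≤ t + 2, Runs (onTop r f) σ t' τ := by
  rcases a with _ | _ | _
  · exact ⟨_, le_rfl, .iteFalse (by simp [ha]) (.iteFalse (by simp [ha]) h)⟩
  · exact ⟨_, le_rfl, .iteFalse (by simp [ha]) (.iteTrue ha h)⟩
  · exact ⟨_, by omega, .iteTrue ha h⟩

/-- Move the word on the stack `r`, reversed, onto the stack `d`. -/
def move (r d : ℕ) : Prog := .loop r (onTop r fun a => .seq (.pop r) (.push d a))

theorem runs_move {r d : ℕ} (h : r ≠ d) (w : List Letter) : ∀ σ : Store, σ r = w →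
    ∃ t ≤ 5 * w.length + 1, Runs (move r d) σ t
      (Function.update (Function.update σ r []) d (w.reverse ++ σ d)) := by
  induction w with
  | nil =>
    intro σ hσ
    refine ⟨1, by simp, (Runs.loopDone hσ).cast ?_⟩
    funext i
    by_cases h1 : i = d
    · subst h1; simp
    · by_cases h2 : i = r
      · subst h2; simp [h1, hσ]
      · simp [h1, h2]
  | cons a w ih =>
    intro σ hσ
    obtain ⟨t, ht, hr⟩ := runs_onTop (f := fun a => .seq (.pop r) (.push d a)) (r := r) (a := a)
      (by simp [hσ]) (.seq (.pop r σ) (.push d a _))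
    obtain ⟨t', ht', hr'⟩ := ih _ (by simp [hσ, h] :
      Function.update (Function.update σ r (σ r).tail) d
        (a :: Function.update σ r (σ r).tail d) r = w)
    refine ⟨_, ?_, (Runs.loopStep (by simp [hσ]) hr hr').cast ?_⟩
    · simp only [List.length_cons]; omega
    · funext i
      by_cases h1 : i = d
      · subst h1; simp [h.symm]
      · by_cases h2 : i = r
        · subst h2; simp [h1]
        · simp [h1, h2]

/-- Move the word on the stack `r`, reversed, onto each of the stacks `d` and `e`. -/
def moveTwice (r d e : ℕ) : Prog :=
  .loop r (onTop r fun a => .seq (.pop r) (.seq (.push d a) (.push e a)))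

theorem runs_moveTwice {r d e : ℕ} (h : r ≠ d) (h' : r ≠ e) (hde : d ≠ e) (w : List Letter) :
    ∀ σ : Store, σ r = w → ∃ t ≤ 6 * w.length + 1, Runs (moveTwice r d e) σ t
      (Function.update (Function.update (Function.update σ r []) d (w.reverse ++ σ d)) e
        (w.reverse ++ σ e)) := by
  induction w with
  | nil =>
    intro σ hσ
    refine ⟨1, by simp, (Runs.loopDone hσ).cast ?_⟩
    funext i
    by_cases h1 : i = d
    · subst h1; simp [hde]
    · by_cases h2 : i = r
      · subst h2; simp [h1, h', hσ]
      · by_cases h3 : i = e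
        · subst h3; simp
        · simp [h1, h2, h3]
  | cons a w ih =>
    intro σ hσ
    obtain ⟨t, ht, hr⟩ := runs_onTop
      (f := fun a => .seq (.pop r) (.seq (.push d a) (.push e a))) (r := r) (a := a)
      (by simp [hσ]) (.seq (.pop r σ) (.seq (.push d a _) (.push e a _)))
    obtain ⟨t', ht', hr'⟩ := ih _ (by simp [hσ, h, h'] :
      Function.update (Function.update (Function.update σ r (σ r).tail) d
        (a :: Function.update σ r (σ r).tail d)) e
        (a :: Function.update (Function.update σ r (σ r).tail) d
          (a :: Function.update σ r (σ r).tail d) e) r = w)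
    refine ⟨_, ?_, (Runs.loopStep (by simp [hσ]) hr hr').cast ?_⟩
    · simp only [List.length_cons]; omega
    · funext i
      by_cases h1 : i = d
      · subst h1; simp [h.symm, hde]
      · by_cases h2 : i = r
        · subst h2; simp [h1, h']
        · by_cases h3 : i = e
          · subst h3; simp [h1, h'.symm]
          · simp [h1, h2, h3]

/-- Empty the stack `r`. -/
def clear (r : ℕ) : Prog := .loop r (.pop r)

theorem runs_clear (r : ℕ) (w : List Letter) : ∀ σ : Store, σ r = w →
    ∃ t ≤ 2 * w.length + 1, Runs (clear r) σ t (Function.update σ r []) := by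
  induction w with
  | nil =>
    intro σ hσ
    exact ⟨1, by simp, (Runs.loopDone hσ).cast (by rw [← hσ]; simp)⟩
  | cons a w ih =>
    intro σ hσ
    obtain ⟨t', ht', hr'⟩ := ih _ (by simp [hσ] : Function.update σ r (σ r).tail r = w)
    refine ⟨_, ?_, (Runs.loopStep (by simp [hσ]) (.pop r σ) hr').cast (by simp)⟩
    simp only [List.length_cons]; omega

/-- Replace the word on the stack `d` by the word on the stack `s`, by way of the empty
stack `e`. -/
def assign (d s e : ℕ) : Prog := .seq (clear d) (.seq (move s e) (moveTwice e d s))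

theorem runs_assign {d s e : ℕ} (hds : d ≠ s) (hde : d ≠ e) (hse : s ≠ e) (σ : Store)
    (he : σ e = []) : ∃ t ≤ 11 * (σ s).length + 2 * (σ d).length + 3,
      Runs (assign d s e) σ t (Function.update σ d (σ s)) := by
  obtain ⟨t1, h1, r1⟩ := runs_clear d _ σ rfl
  obtain ⟨t2, h2, r2⟩ := runs_move hse (σ s) (Function.update σ d []) (by simp [hds.symm])
  obtain ⟨t3, h3, r3⟩ := runs_moveTwice (hde.symm) hse.symm hds (σ s).reverse
    (Function.update (Function.update (Function.update σ d []) s []) e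
      ((σ s).reverse ++ Function.update σ d [] e)) (by simp [hde.symm, he])
  refine ⟨_, ?_, (Runs.seq r1 (.seq r2 r3)).cast ?_⟩
  · simp only [List.length_reverse] at h3; omega
  · funext i
    by_cases a1 : i = d
    · subst a1; simp [hds, hde]
    · by_cases a2 : i = s
      · subst a2; simp [a1, hse]
      · by_cases a3 : i = e
        · subst a3; simp [a1, a2, he]
        · simp [a1, a2, a3]

/-! ### Transformations of the store in polynomial time -/

/-- Some program turns the store `σ a` into exactly the store `τ a`, for all `a`, in time polynomial
in the size of `σ a`. As the final store is prescribed completely, such transformations can be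
composed. -/
def Transforms {α : Type} (σ τ : α → Store) : Prop :=
  ∃ (P : Prog) (b : Polynomial ℕ) (K : ℕ), ∀ a, Below K (σ a) ∧ Below K (τ a) ∧
    ∃ t, Runs P (σ a) t (τ a) ∧ t ≤ b.eval (size K (σ a))

variable {α β : Type}

theorem Transforms.comp {σ τ : β → Store} (h : Transforms σ τ) (φ : α → β) :
    Transforms (fun a => σ (φ a)) (fun a => τ (φ a)) := by
  obtain ⟨P, b, K, h⟩ := h
  exact ⟨P, b, K, fun a => h (φ a)⟩

theorem Transforms.refl {σ : α → Store} {K : ℕ} (h : ∀ a, Below K (σ a)) : Transforms σ σ :=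
  ⟨.skip, 1, K, fun a => ⟨h a, h a, 1, .skip _, by simp⟩⟩

theorem Transforms.trans {σ τ υ : α → Store} (h : Transforms σ τ) (h' : Transforms τ υ) :
    Transforms σ υ := by
  obtain ⟨P, b, K, h⟩ := h
  obtain ⟨P', b', K', h'⟩ := h'
  refine ⟨.seq P P', b + b'.comp (Polynomial.X + b), max K K', fun a => ?_⟩
  obtain ⟨h1, -, t, h3, h4⟩ := h a
  obtain ⟨-, h2', t', h3', h4'⟩ := h' a
  refine ⟨h1.mono (le_max_left _ _), h2'.mono (le_max_right _ _), t + t', .seq h3 h3', ?_⟩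
  have e1 : t ≤ b.eval (size (max K K') (σ a)) :=
    h4.trans (monotone_eval b (size_mono (le_max_left _ _) _))
  have e2 : t' ≤ b'.eval (size (max K K') (τ a)) :=
    h4'.trans (monotone_eval b' (size_mono (le_max_right _ _) _))
  have e3 := h3.size_le (max K K')
  simp only [Polynomial.eval_add, Polynomial.eval_comp, Polynomial.eval_X]
  have e4 : t' ≤ b'.eval (size (max K K') (σ a) + b.eval (size (max K K') (σ a))) :=
    e2.trans (monotone_eval b' (by omega))
  omega

theorem Transforms.below_left {σ τ : α → Store} (h : Transforms σ τ) :
    ∃ K, ∀ a, Below K (σ a) := by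
  obtain ⟨P, b, K, h⟩ := h
  exact ⟨K, fun a => (h a).1⟩

theorem Transforms.below_right {σ τ : α → Store} (h : Transforms σ τ) :
    ∃ K, ∀ a, Below K (τ a) := by
  obtain ⟨P, b, K, h⟩ := h
  exact ⟨K, fun a => (h a).2.1⟩

theorem below_update {K d : ℕ} {σ : Store} (h : Below K σ) (v : List Letter) :
    Below (max K (d + 1)) (Function.update σ d v) := by
  intro i hi
  rw [max_le_iff] at hi
  rw [Function.update_of_ne (by omega)]
  exact h i hi.1

theorem Transforms.clear {σ : α → Store} {K : ℕ} (h : ∀ a, Below K (σ a)) (d : ℕ) :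
    Transforms σ fun a => Function.update (σ a) d [] := by
  refine ⟨Machine.clear d, 2 * Polynomial.X + 1, max K (d + 1), fun a =>
    ⟨(h a).mono (le_max_left _ _), below_update (h a) _, ?_⟩⟩
  obtain ⟨t, h1, h2⟩ := runs_clear d _ (σ a) rfl
  refine ⟨t, h2, ?_⟩
  have := length_le_size (lt_max_of_lt_right (Nat.lt_succ_self d) : d < max K (d + 1)) (σ a)
  simp
  omega

theorem Transforms.assign {σ : α → Store} {K d s e : ℕ} (h : ∀ a, Below K (σ a)) (hds : d ≠ s)
    (hde : d ≠ e) (hse : s ≠ e) (he : ∀ a, σ a e = []) :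
    Transforms σ fun a => Function.update (σ a) d (σ a s) := by
  refine ⟨Machine.assign d s e, 13 * Polynomial.X + 3, max (K + s + 1) (d + 1), fun a =>
    ⟨(h a).mono (by omega), below_update ((h a).mono (by omega)) _, ?_⟩⟩
  obtain ⟨t, h1, h2⟩ := runs_assign hds hde hse (σ a) (he a)
  refine ⟨t, h2, ?_⟩
  have h3 := length_le_size (by omega : d < max (K + s + 1) (d + 1)) (σ a)
  have h4 := length_le_size (by omega : s < max (K + s + 1) (d + 1)) (σ a)
  simp only [Polynomial.eval_add, Polynomial.eval_mul, Polynomial.eval_X,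
    Polynomial.eval_ofNat]
  omega

/-- Clearing a range of stacks. -/
theorem Transforms.clearRange {σ : α → Store} {K : ℕ} (h : ∀ a, Below K (σ a)) (m n : ℕ) :
    Transforms σ fun a i => if m ≤ i ∧ i < m + n then [] else σ a i := by
  induction n with
  | zero =>
    refine (Transforms.refl h).trans ?_
    convert Transforms.refl h using 3
    split_ifs
    · omega
    · rfl
  | succ n ih =>
    refine ih.trans ?_
    obtain ⟨K', hK'⟩ := ih.below_right
    convert Transforms.clear hK' (m + n) using 2 with a
    funext i
    by_cases hi : i = m + n
    · subst hi; simp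
    · rw [Function.update_of_ne hi]
      congr 1
      simp only [eq_iff_iff]; omega

/-- Copying `n` stacks of the store to the stacks from number `m` on. -/
theorem Transforms.copyRange {σ : α → Store} {K m e : ℕ} (h : ∀ a, Below K (σ a)) (idx : ℕ → ℕ)
    (n : ℕ) (hidx : ∀ i < n, idx i < m ∨ m + n ≤ idx i) (he : m + n ≤ e)
    (he' : ∀ i < n, idx i ≠ e) (hσ : ∀ a, σ a e = []) :
    Transforms σ fun a i => if m ≤ i ∧ i < m + n then σ a (idx (i - m)) else σ a i := by
  suffices H : ∀ k ≤ n, Transforms σ fun a i =>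
      if m ≤ i ∧ i < m + k then σ a (idx (i - m)) else σ a i from H n le_rfl
  intro k
  induction k with
  | zero =>
    intro _
    convert Transforms.refl h using 3
    split_ifs
    · omega
    · rfl
  | succ k ih =>
    intro hk
    have ih := ih (by omega)
    refine ih.trans ?_
    obtain ⟨K', hK'⟩ := ih.below_right
    have h1 := hidx k (by omega)
    have h2 := he' k (by omega)
    convert Transforms.assign hK' (d := m + k) (s := idx k) (e := e) (by omega) (by omega) h2 ?_
      using 2 with a
    · funext i
      by_cases hi : i = m + k
      · subst hi
        rw [Function.update_self, if_pos (by omega), if_neg (by omega)]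
        simp
      · rw [Function.update_of_ne hi]
        congr 1
        simp only [eq_iff_iff]; omega
    · intro a
      rw [if_neg (by omega)]
      exact hσ a

/-- Selecting stacks: in the new store, the first `n` stacks hold the words of the stacks
`idx 0, …, idx (n - 1)`, and the other stacks are empty. -/
theorem Transforms.reindex {σ : α → Store} {K : ℕ} (h : ∀ a, Below K (σ a)) (idx : ℕ → ℕ) (n : ℕ) :
    Transforms σ fun a i => if i < n then σ a (idx i) else [] := by
  -- The words are first copied to the stacks from `B` on, out of the way of all sources.
  let B := K + n + (∑ i ∈ Finset.range n, idx i) + 1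
  have hB : ∀ i < n, idx i < B := by
    intro i hi
    have := Finset.single_le_sum (f := idx) (fun _ _ => Nat.zero_le _) (Finset.mem_range.2 hi)
    omega
  have h1 := Transforms.copyRange (m := B) (e := B + n) h idx n
    (fun i hi => Or.inl (hB i hi)) le_rfl (fun i hi => by have := hB i hi; omega)
    (fun a => h a _ (by omega))
  obtain ⟨K1, hK1⟩ := h1.below_right
  have h2 := Transforms.copyRange (m := 0) (e := B + n) hK1 (fun i => B + i) n
    (fun i hi => Or.inr (by omega)) (by omega) (fun i hi => by omega)
    (fun a => by rw [if_neg (by omega)]; exact h a _ (by omega))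
  obtain ⟨K2, hK2⟩ := h2.below_right
  have h3 := Transforms.clearRange hK2 n (B + n)
  convert (h1.trans h2).trans h3 using 3 with a i
  by_cases hi : i < n
  · rw [if_pos hi, if_neg (by omega), if_pos (by omega), if_pos (by omega)]
    simp
  · rw [if_neg hi]
    by_cases h4 : i < n + (B + n)
    · rw [if_pos (by omega)]
    · rw [if_neg (by omega), if_neg (by omega), if_neg (by omega)]
      exact (h a i (by omega)).symm

theorem size_le_size_glue (K k : ℕ) (L σ : Store) : size K σ ≤ size (k + K) (glue k L σ) := by
  unfold size
  rw [Finset.sum_range_add]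
  simp

theorem Below.glue {K k : ℕ} {σ : Store} (h : Below K σ) (L : Store) :
    Below (k + K) (glue k L σ) := by
  intro i hi
  obtain ⟨j, rfl⟩ := Nat.exists_eq_add_of_le (show k ≤ i by omega)
  rw [glue_add]
  exact h j (by omega)

/-- A transformation can be applied to the stacks from number `k` on. -/
theorem Transforms.frame {σ τ : α → Store} (h : Transforms σ τ) (k : ℕ) (L : α → Store) :
    Transforms (fun a => glue k (L a) (σ a)) (fun a => glue k (L a) (τ a)) := by
  obtain ⟨P, b, K, h⟩ := h
  refine ⟨P.shift k, b, k + K, fun a => ?_⟩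
  obtain ⟨h1, h2, t, h3, h4⟩ := h a
  exact ⟨h1.glue _, h2.glue _, t, h3.shift k (L a),
    h4.trans (monotone_eval b (size_le_size_glue _ _ _ _))⟩

/-- Two transformations of the same store can be carried out side by side. -/
theorem Transforms.pair {σ τ υ : α → Store} (h : Transforms σ τ) (h' : Transforms σ υ) {k : ℕ}
    (hk : ∀ a, Below k (τ a)) : Transforms σ fun a => glue k (τ a) (υ a) := by
  obtain ⟨K, hK⟩ := h.below_left
  obtain ⟨m, hm⟩ := h'.below_right
  -- The store is duplicated; the copy in the upper half becomes `υ`, and the halves are exchanged.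
  have h1 : Transforms σ fun a => glue K (σ a) (σ a) := by
    convert Transforms.reindex hK (fun i => if i < K then i else i - K) (K + K) using 3 with a i
    unfold glue
    split_ifs
    · rfl
    · omega
    · rfl
    · exact hK a _ (by omega)
  have h2 : Transforms (fun a => glue K (σ a) (υ a)) fun a => glue m (υ a) (σ a) := by
    convert Transforms.reindex (fun a => (hm a).glue (k := K) (σ a))
      (fun i => if i < m then K + i else i - m) (m + K) using 3 with a i
    by_cases h3 : i < m
    · simp [glue, h3, show i < m + K by omega]
    · by_cases h4 : i < m + K
      · simp [glue, h3, h4, show i - m < K by omega]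
      · simp only [glue, h3, h4, if_false]
        exact hK a _ (by omega)
  have h3 : Transforms (fun a => glue m (υ a) (τ a)) fun a => glue k (τ a) (υ a) := by
    convert Transforms.reindex (fun a => (hk a).glue (k := m) (υ a))
      (fun i => if i < k then m + i else i - k) (k + m) using 3 with a i
    by_cases h3 : i < k
    · simp [glue, h3, show i < k + m by omega]
    · by_cases h4 : i < k + m
      · simp [glue, h3, h4, show i - k < m by omega]
      · simp only [glue, h3, h4, if_false]
        exact hm a _ (by omega)
  exact h1.trans ((h'.frame K σ).trans (h2.trans ((h.frame m υ).trans h3)))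

/-- Branching on the top symbol of the stack `0`. -/
theorem Transforms.ite {σ τ υ : α → Store} (l : Letter) (h : Transforms σ τ)
    (h' : Transforms σ υ) :
    Transforms σ fun a => if (σ a 0).head? = some l then τ a else υ a := by
  obtain ⟨P, b, K, h⟩ := h
  obtain ⟨P', b', K', h'⟩ := h'
  refine ⟨.ite 0 l P P', b + b' + 1, max K K', fun a => ?_⟩
  obtain ⟨h1, h2, t, h3, h4⟩ := h a
  obtain ⟨h1', h2', t', h3', h4'⟩ := h' a
  have e1 : t ≤ b.eval (size (max K K') (σ a)) :=
    h4.trans (monotone_eval b (size_mono (le_max_left _ _) _))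
  have e2 : t' ≤ b'.eval (size (max K K') (σ a)) :=
    h4'.trans (monotone_eval b' (size_mono (le_max_right _ _) _))
  refine ⟨h1.mono (le_max_left _ _), ?_, ?_⟩
  · show Below _ (if _ then _ else _)
    split_ifs
    · exact h2.mono (le_max_left _ _)
    · exact h2'.mono (le_max_right _ _)
  · simp only [Polynomial.eval_add, Polynomial.eval_one]
    by_cases hc : (σ a 0).head? = some l
    · exact ⟨t + 1, (Runs.iteTrue hc h3).cast (by rw [if_pos hc]), by omega⟩
    · exact ⟨t' + 1, (Runs.iteFalse hc h3').cast (by rw [if_neg hc]), by omega⟩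

/-- Iteration, as long as the stack `0` is not empty: `S a j` is the store after `j` rounds. The
number of rounds and the sizes of all intermediate stores have to be polynomially bounded. -/
theorem Transforms.loop (T : α → ℕ) (S : α → ℕ → Store)
    (hpos : ∀ a, ∀ j < T a, S a j 0 ≠ []) (hend : ∀ a, S a (T a) 0 = [])
    (hstep : Transforms (fun p : Σ a, Fin (T a) => S p.1 p.2) fun p => S p.1 (p.2 + 1))
    {K : ℕ} (hK : ∀ a, ∀ j ≤ T a, Below K (S a j)) (bT bS : Polynomial ℕ)
    (hT : ∀ a, T a ≤ bT.eval (size K (S a 0)))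
    (hS : ∀ a, ∀ j ≤ T a, size K (S a j) ≤ bS.eval (size K (S a 0))) :
    Transforms (fun a => S a 0) fun a => S a (T a) := by
  obtain ⟨P, b, K', h⟩ := hstep
  refine ⟨.loop 0 P, bT * (b.comp bS + 1) + 1, K, fun a => ⟨hK a 0 (Nat.zero_le _),
    hK a _ le_rfl, ?_⟩⟩
  set s := size K (S a 0)
  have hb : ∀ j < T a, ∃ t ≤ b.eval (bS.eval s), Runs P (S a j) t (S a (j + 1)) := by
    intro j hj
    obtain ⟨-, -, t, h3, h4⟩ := h ⟨a, ⟨j, hj⟩⟩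
    refine ⟨t, h4.trans (monotone_eval b (le_trans ?_ (hS a j hj.le))), h3⟩
    -- Above `K` all stacks are empty, so `K` may replace the larger of the two bounds.
    have : size (max K K') (S a j) = size K (S a j) := by
      unfold size
      symm
      refine Finset.sum_subset (Finset.range_mono (le_max_left _ _)) fun i _ hi => ?_
      rw [hK a j hj.le i (by simpa using hi)]; rfl
    exact this ▸ size_mono (le_max_right _ _) _
  have key : ∀ d j, j + d = T a →
      ∃ t ≤ d * (b.eval (bS.eval s) + 1) + 1, Runs (.loop 0 P) (S a j) t (S a (T a)) := by
    intro d
    induction d with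
    | zero =>
      intro j hj
      obtain rfl : j = T a := by omega
      exact ⟨1, by simp, .loopDone (hend a)⟩
    | succ d ih =>
      intro j hj
      obtain ⟨t, h1, h2⟩ := hb j (by omega)
      obtain ⟨t', h1', h2'⟩ := ih (j + 1) (by omega)
      refine ⟨_, ?_, .loopStep (hpos a j (by omega)) h2 h2'⟩
      rw [Nat.succ_mul]
      omega
  obtain ⟨t, h1, h2⟩ := key (T a) 0 (by omega)
  refine ⟨t, h2, h1.trans ?_⟩
  simp only [Polynomial.eval_add, Polynomial.eval_mul, Polynomial.eval_one, Polynomial.eval_comp]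
  gcongr
  exact hT a

end Machine

namespace Machine

variable {α β γ δ S : Type}

/-! ### Functions from lists of words to lists of words -/

/-- The total length of a list of words. -/
def total (l : List (List Letter)) : ℕ := (l.map List.length).sum

@[simp] theorem total_nil : total [] = 0 := rfl

@[simp] theorem total_cons (w : List Letter) (l : List (List Letter)) :
    total (w :: l) = w.length + total l := by simp [total]

@[simp] theorem total_append (l l' : List (List Letter)) :
    total (l ++ l') = total l + total l' := by simp [total]

theorem below_initial {K : ℕ} {l : List (List Letter)} (h : l.length ≤ K) :
    Below K (initial l) := fun _ hi => List.getD_eq_default _ _ (h.trans hi)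

theorem size_initial {K : ℕ} {l : List (List Letter)} (h : l.length ≤ K) :
    size K (initial l) = total l := by
  induction l generalizing K with
  | nil => simp [size, initial]
  | cons w l ih =>
    obtain ⟨K, rfl⟩ : ∃ k, K = k + 1 := ⟨K - 1, by simp at h; omega⟩
    have := ih (K := K) (by simpa using h)
    rw [total_cons, ← this]
    simp [size, Finset.sum_range_succ', initial, add_comm]

theorem size_initial_le (K : ℕ) (l : List (List Letter)) : size K (initial l) ≤ total l :=
  (size_mono (le_max_left K l.length) _).trans (size_initial (le_max_right _ _)).le

theorem glue_initial {k : ℕ} {l l' : List (List Letter)} (h : l.length = k) :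
    glue k (initial l) (initial l') = initial (l ++ l') := by
  subst h
  funext i
  by_cases hi : i < l.length
  · simp [glue, initial, hi, List.getElem?_append_left]
  · simp [glue, initial, hi, List.getElem?_append_right (not_lt.1 hi)]

/-- The length of the lists `inp a` is bounded. -/
class Bounded (inp : α → List (List Letter)) : Prop where
  exists_le : ∃ K, ∀ a, (inp a).length ≤ K

/-- The list of words `out a` can be computed from the list of words `inp a` in polynomial time,
where all other stacks are left empty. -/
def Computes (inp out : α → List (List Letter)) : Prop :=
  Transforms (fun a => initial (inp a)) fun a => initial (out a)

namespace Computes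

variable {inp mid out out' : α → List (List Letter)}

theorem trans (h : Computes inp mid) (h' : Computes mid out) : Computes inp out :=
  Transforms.trans h h'

theorem comp {inp out : β → List (List Letter)} (h : Computes inp out) (φ : α → β) :
    Computes (fun a => inp (φ a)) fun a => out (φ a) := Transforms.comp h φ

theorem append {k : ℕ} (h : Computes inp out) (h' : Computes inp out')
    (hk : ∀ a, (out a).length = k) : Computes inp fun a => out a ++ out' a := by
  have := Transforms.pair h h' (k := k) fun a => below_initial (hk a).le
  unfold Computes
  convert this using 3 with a
  exact (glue_initial (hk a)).symm

theorem select [hb : Bounded inp] (idx : List ℕ) :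
    Computes inp fun a => idx.map fun i => (inp a).getD i [] := by
  obtain ⟨K, hK⟩ := hb.exists_le
  have := Transforms.reindex (fun a => below_initial (hK a)) (fun i => idx.getD i 0) idx.length
  unfold Computes
  convert this using 3 with a i
  by_cases hi : i < idx.length
  · simp [initial, hi]
  · simp [initial, hi]

theorem drop {pre : α → List (List Letter)} {k : ℕ} [hb : Bounded inp]
    (hk : ∀ a, (pre a).length = k) : Computes (fun a => pre a ++ inp a) inp := by
  obtain ⟨K, hK⟩ := hb.exists_le
  have := Transforms.reindex (σ := fun a => initial (pre a ++ inp a)) (K := k + K)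
    (fun a => below_initial (by simpa [hk a] using hK a)) (fun i => k + i) K
  unfold Computes
  convert this using 3 with a i
  by_cases hi : i < K
  · simp [initial, hi, ← hk a, List.getElem?_append_right]
  · simp [initial, hi, (hK a).trans (not_lt.1 hi)]

end Computes

/-- A computable function, seen as a transformation of the whole store: the stacks that the program
may have used are emptied at the end. -/
theorem PolyTimeComputable.computes {inp : α → List (List Letter)} {out : α → List Letter}
    (h : PolyTimeComputable inp out) [hb : Bounded inp] : Computes inp fun a => [out a] := by
  obtain ⟨P, b, h⟩ := h
  obtain ⟨K, hK⟩ := hb.exists_le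
  choose t τ h1 h2 h3 using h
  have h4 : ∀ a, Below (max K P.bound) (τ a) := by
    intro a i hi
    rw [max_le_iff] at hi
    rw [(h1 a).eq_of_bound_le i hi.2]
    exact below_initial (hK a) i hi.1
  have h5 : Transforms (fun a => initial (inp a)) τ := by
    refine ⟨P, b, max K P.bound, fun a =>
      ⟨(below_initial (hK a)).mono (le_max_left _ _), h4 a, t a, h1 a, ?_⟩⟩
    rw [size_initial ((hK a).trans (le_max_left _ _))]
    exact h3 a
  have h6 := h5.trans (Transforms.reindex h4 id 1)
  unfold Computes
  convert h6 using 3 with a i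
  rcases i with _ | i
  · simp [initial, h2]
  · simp [initial]

theorem Computes.polyTimeComputable {inp : α → List (List Letter)} {out : α → List Letter}
    (h : Computes inp fun a => [out a]) : PolyTimeComputable inp out := by
  obtain ⟨P, b, K, h⟩ := h
  refine ⟨P, b, fun a => ?_⟩
  obtain ⟨-, -, t, h1, h2⟩ := h a
  exact ⟨t, _, h1, rfl, h2.trans (monotone_eval b (size_initial_le _ _))⟩

/-- What one step of a fold works on: a letter of the word that is read, the state and the
input. -/
def foldContext (inp : α → List (List Letter)) (enc : S → List (List Letter)) :
    α × Letter × S → List (List Letter) :=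
  fun q => [q.2.1] :: (enc q.2.2 ++ inp q.1)

theorem computes_head (rest : α → List (List Letter)) [hb : Bounded rest] (l : α → Letter)
    (w : α → List Letter) :
    Computes (fun a => (l a :: w a) :: rest a) fun a => [l a] :: rest a := by
  obtain ⟨K, hK⟩ := hb.exists_le
  refine ⟨onTop 0 fun a => .seq (clear 0) (.push 0 a), 2 * Polynomial.X + 4, K + 1, fun a =>
    ⟨below_initial (by simpa using hK a), below_initial (by simpa using hK a), ?_⟩⟩
  obtain ⟨t, h1, h2⟩ := runs_clear 0 (l a :: w a) (initial ((l a :: w a) :: rest a)) rfl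
  obtain ⟨t', h3, h4⟩ := runs_onTop (f := fun a => .seq (clear 0) (.push 0 a)) (a := l a)
    (show (initial ((l a :: w a) :: rest a) 0).head? = some (l a) from rfl)
    (.seq h2 (.push 0 (l a) _))
  refine ⟨t', h4.cast ?_, ?_⟩
  · funext i
    rcases i with _ | i <;> simp [initial]
  · rw [size_initial (by simpa using hK a), total_cons]
    simp at h1 ⊢
    omega

theorem computes_tail (rest : α → List (List Letter)) [hb : Bounded rest] (w : α → List Letter) :
    Computes (fun a => w a :: rest a) fun a => (w a).tail :: rest a := by
  obtain ⟨K, hK⟩ := hb.exists_le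
  refine ⟨.pop 0, 1, K + 1, fun a =>
    ⟨below_initial (by simpa using hK a), below_initial (by simpa using hK a), 1, ?_, by simp⟩⟩
  refine (Runs.pop 0 _).cast ?_
  funext i
  rcases i with _ | i <;> simp [initial]

theorem computes_push (rest : α → List (List Letter)) [hb : Bounded rest] (l : Letter)
    (w : α → List Letter) :
    Computes (fun a => w a :: rest a) fun a => (l :: w a) :: rest a := by
  obtain ⟨K, hK⟩ := hb.exists_le
  refine ⟨.push 0 l, 1, K + 1, fun a =>
    ⟨below_initial (by simpa using hK a), below_initial (by simpa using hK a), 1, ?_, by simp⟩⟩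
  refine (Runs.push 0 l _).cast ?_
  funext i
  rcases i with _ | i <;> simp [initial]

/-- Recursion on the letters of a word, where the state is a tuple of words. All intermediate
states have to be polynomially bounded. -/
theorem Computes.fold {inp : α → List (List Letter)} [hb : Bounded inp] {w : α → List Letter}
    {enc : S → List (List Letter)} {k : ℕ} (hk : ∀ s, (enc s).length = k)
    {step : α → Letter → S → S} {init : α → S} (hw : Computes inp fun a => [w a])
    (hinit : Computes inp fun a => enc (init a))
    (hstep : Computes (foldContext inp enc) fun q => enc (step q.1 q.2.1 q.2.2))
    (b : Polynomial ℕ)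
    (hsize : ∀ a u, u <+: w a →
      total (enc (u.foldl (fun s l => step a l s) (init a))) ≤ b.eval (total (inp a))) :
    Computes inp fun a => enc ((w a).foldl (fun s l => step a l s) (init a)) := by
  obtain ⟨K, hK⟩ := hb.exists_le
  let st : α → ℕ → S := fun a j => ((w a).take j).foldl (fun s l => step a l s) (init a)
  let L : α → ℕ → List (List Letter) := fun a j => (w a).drop j :: (enc (st a j) ++ inp a)
  have hL : ∀ a j, (L a j).length ≤ k + K + 1 := by
    intro a j
    have := hK a
    simp only [L, List.length_cons, List.length_append, hk]
    omega
  have hinp : Computes inp inp := Transforms.refl fun a => below_initial (hK a)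
  have h0 : Computes inp fun a => L a 0 := by
    have := hw.append (hinit.append hinp fun a => hk _) (k := 1) fun a => rfl
    simpa [L, st] using this
  -- One round of the loop, with the letter that is read already split off.
  have hround : Computes
      (fun p : List Letter × α × Letter × S =>
        (p.2.2.1 :: p.1) :: (enc p.2.2.2 ++ inp p.2.1))
      (fun p => p.1 :: (enc (step p.2.1 p.2.2.1 p.2.2.2) ++ inp p.2.1)) := by
    have : Bounded fun p : List Letter × α × Letter × S => enc p.2.2.2 ++ inp p.2.1 :=
      ⟨k + K, fun p => by simpa [hk] using hK p.2.1⟩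
    have : Bounded fun p : List Letter × α × Letter × S => inp p.2.1 := ⟨K, fun p => hK _⟩
    have : Bounded fun p : List Letter × α × Letter × S =>
        p.1 :: (enc p.2.2.2 ++ inp p.2.1) :=
      ⟨k + K + 1, fun p => by simpa [hk, add_assoc] using hK p.2.1⟩
    have a1 := (computes_head (fun p : List Letter × α × Letter × S => enc p.2.2.2 ++ inp p.2.1)
      (fun p => p.2.2.1) (fun p => p.1)).trans
      (hstep.comp fun p : List Letter × α × Letter × S => p.2)
    have a2 := (computes_tail (fun p : List Letter × α × Letter × S => enc p.2.2.2 ++ inp p.2.1)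
      (fun p : List Letter × α × Letter × S => p.2.2.1 :: p.1)).trans
      (Computes.select (inp := fun p : List Letter × α × Letter × S =>
        p.1 :: (enc p.2.2.2 ++ inp p.2.1)) [0])
    have a3 : Computes
        (fun p : List Letter × α × Letter × S => (p.2.2.1 :: p.1) :: (enc p.2.2.2 ++ inp p.2.1))
        fun p => inp p.2.1 :=
      Computes.drop
      (pre := fun p : List Letter × α × Letter × S => (p.2.2.1 :: p.1) :: enc p.2.2.2) (k := k + 1)
        fun p => by simp [hk]
    exact a2.append (a1.append a3 fun p => hk _) (k := 1) fun p => rfl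
  have hloop := Transforms.loop (fun a => (w a).length) (fun a j => initial (L a j)) (K := k + K + 1)
    (fun a j hj => by simpa [L, initial] using hj)
    (fun a => by simp [L, initial]) (by
      have := hround.comp fun p : Σ a, Fin (w a).length =>
        ((w p.1).drop (p.2 + 1), p.1, (w p.1)[p.2], st p.1 p.2)
      refine cast ?_ this
      unfold Computes
      congr 1
      · funext p
        simp only [L]
        rw [List.drop_eq_getElem_cons p.2.2]
        rfl
      · funext p
        simp only [L, st]
        rw [← List.take_append_getElem p.2.2, List.foldl_append]
        rfl)
    (fun a j _ => below_initial (hL a j)) Polynomial.X (Polynomial.X + b)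
    (fun a => by rw [size_initial (hL a 0)]; simp [L])
    (fun a j _ => by
      have h1 := hsize a _ (List.take_prefix j (w a))
      have h2 := monotone_eval b (show total (inp a) ≤ total (L a 0) by
        simp only [L, total_cons, total_append]; omega)
      rw [size_initial (hL a 0), size_initial (hL a j)]
      simp only [Polynomial.eval_add, Polynomial.eval_X]
      have h3 : total (L a j) = ((w a).length - j) + (total (enc (st a j)) + total (inp a)) := by
        simp [L]
      have h4 : total (L a 0) = (w a).length + (total (enc (st a 0)) + total (inp a)) := by
        simp [L]
      have h5 : total (enc (st a j)) ≤ b.eval (total (inp a)) := h1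
      simp only at h2
      omega)
  refine (h0.trans hloop).trans ?_
  have : Bounded fun a => L a (w a).length := ⟨_, fun a => hL a _⟩
  have := Computes.select (inp := fun a => L a (w a).length) ((List.range k).map (· + 1))
  refine cast ?_ this
  congr 1
  funext a
  have hlen := hk (st a (w a).length)
  refine List.ext_getElem (by simp [hk]) fun i h1 h2 => ?_
  have hi : i < k := by simpa using h1
  simp only [st, List.take_length] at hlen
  simp [L, st, List.getElem?_append_left, hlen, hi]

end Machine

namespace Machine

variable {α β γ δ S : Type}

/-! ### Polynomial-time functions on coded types -/

/-- A representation of the elements of a type by tuples of words. -/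
class Coded (β : Type) where
  enc : β → List (List Letter)
  arity : ℕ
  length_enc : ∀ b, (enc b).length = arity

open Coded

instance : Coded (List Letter) := ⟨fun w => [w], 1, fun _ => rfl⟩
instance : Coded ℕ := ⟨fun n => [unary n], 1, fun _ => rfl⟩
instance : Coded Bool := ⟨fun b => [word [b]], 1, fun _ => rfl⟩
instance : Coded (List Bool) := ⟨fun l => [word l], 1, fun _ => rfl⟩
instance : Coded (List (List Bool)) := ⟨fun h => [words h], 1, fun _ => rfl⟩
instance : Coded ℚ := ⟨fun q => [encodeRat q], 1, fun _ => rfl⟩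
instance [Coded β] [Coded γ] : Coded (β × γ) :=
  ⟨fun p => enc p.1 ++ enc p.2, arity β + arity γ, fun p => by simp [length_enc]⟩

theorem enc_letters (w : List Letter) : enc w = [w] := rfl
theorem enc_nat (n : ℕ) : enc n = [unary n] := rfl
theorem enc_bool (b : Bool) : enc b = [word [b]] := rfl
theorem enc_bits (l : List Bool) : enc l = [word l] := rfl
theorem enc_messages (h : List (List Bool)) : enc h = [words h] := rfl
theorem enc_prod [Coded β] [Coded γ] (p : β × γ) : enc p = enc p.1 ++ enc p.2 := rfl

@[simp] theorem total_enc_letters (w : List Letter) : total (enc w) = w.length := by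
  simp [enc_letters]
@[simp] theorem total_enc_nat (n : ℕ) : total (enc n) = n := by simp [enc_nat, unary]
@[simp] theorem total_enc_bool (b : Bool) : total (enc b) = 1 := by simp [enc_bool, word]
@[simp] theorem total_enc_bits (l : List Bool) : total (enc l) = l.length := by
  simp [enc_bits, word]
@[simp] theorem total_enc_messages (h : List (List Bool)) :
    total (enc h) = (words h).length := by simp [enc_messages]
@[simp] theorem total_enc_prod [Coded β] [Coded γ] (p : β × γ) :
    total (enc p) = total (enc p.1) + total (enc p.2) := by simp [enc_prod]

instance [Coded β] : Bounded (enc : β → List (List Letter)) :=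
  ⟨arity β, fun b => (length_enc b).le⟩

instance Bounded.foldContext {inp : α → List (List Letter)} [h : Bounded inp] [Coded S] :
    Bounded (foldContext inp (enc : S → List (List Letter))) := by
  obtain ⟨K, hK⟩ := h.exists_le
  refine ⟨arity S + K + 1, fun q => ?_⟩
  have := hK q.1
  simp only [Machine.foldContext, List.length_cons, List.length_append, length_enc]
  omega

/-- The function `f` is computable in polynomial time, where `a` is given by the words `inp a`. -/
def PolyComp [Coded β] (inp : α → List (List Letter)) (f : α → β) : Prop :=
  Computes inp fun a => enc (f a)

/-- The function `f` between coded types is computable in polynomial time. -/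
abbrev PolyFun [Coded β] [Coded γ] (f : β → γ) : Prop := PolyComp enc f

theorem Computes.const {inp : α → List (List Letter)} [Bounded inp] (ws : List (List Letter)) :
    Computes inp fun _ => ws := by
  induction ws with
  | nil => exact Computes.select []
  | cons w ws ih =>
    refine Computes.append (k := 1) (out := fun _ => [w]) ?_ ih fun _ => rfl
    induction w with
    | nil =>
      have h : Computes inp fun _ => [] := Computes.select []
      have e : initial [[]] = initial [] := by
        funext i
        rcases i with _ | i <;> simp [initial]
      show Transforms _ fun _ => initial [[]]
      rw [e]
      exact h
    | cons l w ih => exact ih.trans (computes_push (hb := ⟨0, fun _ => le_rfl⟩) (fun _ => []) l _)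

theorem iterate_tail (n : ℕ) (w : List γ) : List.tail^[n] w = w.drop n := by
  induction n generalizing w with
  | zero => simp
  | succ n ih => rw [Function.iterate_succ_apply, ih]; cases w <;> simp

namespace PolyComp

variable {inp : α → List (List Letter)} [Coded β] [Coded γ] [Coded S]

theorem congr {f : α → β} {g : α → γ} (hg : PolyComp inp g) (h : ∀ a, enc (f a) = enc (g a)) :
    PolyComp inp f := by
  unfold PolyComp at hg ⊢
  simpa only [h] using hg

theorem comp {f : α → β} {F : β → γ} (hF : PolyFun F) (hf : PolyComp inp f) :
    PolyComp inp fun a => F (f a) := Computes.trans hf (Computes.comp hF f)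

theorem pair {f : α → β} {g : α → γ} (hf : PolyComp inp f) (hg : PolyComp inp g) :
    PolyComp inp fun a => (f a, g a) := Computes.append hf hg fun _ => length_enc _

theorem id : PolyFun (fun b : β => b) := Transforms.refl fun b => below_initial (length_enc b).le

theorem fst {f : α → β × γ} (hf : PolyComp inp f) : PolyComp inp fun a => (f a).1 := by
  refine comp (F := Prod.fst) ?_ hf
  have := Computes.select (inp := (enc : β × γ → _)) (List.range (arity β))
  refine cast ?_ this
  unfold PolyFun PolyComp
  congr 1
  funext p
  refine List.ext_getElem (by simp [length_enc]) fun i h1 h2 => ?_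
  have h3 : i < arity β := by simpa using h1
  simp [enc_prod, List.getElem?_append_left, length_enc, h3]

theorem snd {f : α → β × γ} (hf : PolyComp inp f) : PolyComp inp fun a => (f a).2 :=
  comp (F := Prod.snd) (Computes.drop (inp := fun p : β × γ => enc p.2) (hb := ⟨arity γ, fun p =>
    (length_enc p.2).le⟩) fun p => length_enc p.1) hf

theorem comp₂ {f : α → β} {g : α → γ} [Coded δ] {F : β → γ → δ}
    (hF : PolyFun fun p : β × γ => F p.1 p.2) (hf : PolyComp inp f) (hg : PolyComp inp g) :
    PolyComp inp fun a => F (f a) (g a) :=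
  comp (F := fun p : β × γ => F p.1 p.2) hF (hf.pair hg)

/-- Taking words from the input: those from number `i` on that make up the code of `f a`. -/
theorem get [Bounded inp] {f : α → β} (i : ℕ)
    (h : ∀ a, ∀ j < arity β, (inp a).getD (i + j) [] = (enc (f a)).getD j []) :
    PolyComp inp f := by
  have := Computes.select (inp := inp) ((List.range (arity β)).map (i + ·))
  refine cast ?_ this
  unfold PolyComp
  congr 1
  funext a
  refine List.ext_getElem (by simp [length_enc]) fun j h1 h2 => ?_
  have h3 : j < arity β := by simpa using h1
  have h4 := h a j h3
  simp only [List.map_map, List.getElem_map, List.getElem_range, Function.comp]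
  rw [h4]
  simp [length_enc, h3]

theorem const [Bounded inp] (b : β) : PolyComp inp fun _ => b := Computes.const _

theorem exists_bound [Bounded inp] {f : α → β} (hf : PolyComp inp f) :
    ∃ b : Polynomial ℕ, ∀ a, total (enc (f a)) ≤ b.eval (total (inp a)) := by
  obtain ⟨P, b, K, h⟩ := hf
  refine ⟨Polynomial.X + b, fun a => ?_⟩
  obtain ⟨-, -, t, h1, h2⟩ := h a
  have h3 := h1.size_le (max K (arity β))
  rw [size_initial ((length_enc _).le.trans (le_max_right _ _))] at h3
  have h4 := size_initial_le (max K (arity β)) (inp a)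
  have h5 : t ≤ b.eval (total (inp a)) := h2.trans (monotone_eval b (size_initial_le _ _))
  simp only [Polynomial.eval_add, Polynomial.eval_X] at h3 h4 ⊢
  omega

theorem letter [Bounded inp] :
    PolyComp (foldContext inp (enc : S → _)) fun q => ([q.2.1] : List Letter) :=
  get 0 fun _ j hj => by
    obtain rfl : j = 0 := Nat.lt_one_iff.1 hj
    rfl

theorem state [Bounded inp] : PolyComp (foldContext inp (enc : S → _)) fun q => q.2.2 :=
  get 1 fun q j hj => by
    simp [foldContext, add_comm 1, List.getElem?_append_left, length_enc, hj]

theorem input [Bounded inp] {f : α → β} (hf : PolyComp inp f) :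
    PolyComp (foldContext inp (enc : S → _)) fun q => f q.1 := by
  obtain ⟨K, hK⟩ := (inferInstance : Bounded inp).exists_le
  have := Computes.drop (inp := fun q : α × Letter × S => inp q.1)
    (pre := fun q : α × Letter × S => [q.2.1] :: enc q.2.2) (k := 1 + arity S) (hb := ⟨K, fun q => hK q.1⟩)
    fun q => by simp [length_enc, add_comm]
  exact this.trans (Computes.comp hf fun q : α × Letter × S => q.1)

/-- Recursion on the letters of a word, if every step enlarges the state only by an amount that is
polynomially bounded in terms of the input. -/
theorem fold [Bounded inp] {w : α → List Letter} {step : α → Letter → S → S} {init : α → S}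
    (hw : PolyComp inp w) (hinit : PolyComp inp init)
    (hstep : PolyComp (foldContext inp enc) fun q : α × Letter × S => step q.1 q.2.1 q.2.2)
    (c : Polynomial ℕ) (hgrow : ∀ a l s,
      total (enc (step a l s)) ≤ total (enc s) + c.eval (total (inp a))) :
    PolyComp inp fun a => (w a).foldl (fun s l => step a l s) (init a) := by
  obtain ⟨b1, h1⟩ := hw.exists_bound
  obtain ⟨b2, h2⟩ := hinit.exists_bound
  refine Computes.fold length_enc hw hinit hstep (b2 + b1 * c) fun a u hu => ?_
  have h3 : ∀ (u : List Letter) (s : S), total (enc (u.foldl (fun s l => step a l s) s)) ≤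
      total (enc s) + u.length * c.eval (total (inp a)) := by
    intro u
    induction u with
    | nil => intro s; simp
    | cons l u ih =>
      intro s
      have h4 := ih (step a l s)
      have h5 := hgrow a l s
      simp only [List.foldl_cons, List.length_cons, Nat.succ_mul]
      omega
  refine (h3 u _).trans ?_
  simp only [Polynomial.eval_add, Polynomial.eval_mul]
  have h4 := (hu.length_le.trans_eq (total_enc_letters _).symm).trans (h1 a)
  gcongr
  exact h2 a

/-- Iteration of a function. -/
theorem iterate [Bounded inp] {n : α → ℕ} {step : α → S → S} {init : α → S}
    (hn : PolyComp inp n) (hinit : PolyComp inp init)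
    (hstep : PolyComp (foldContext inp enc) fun q : α × Letter × S => step q.1 q.2.2)
    (c : Polynomial ℕ) (hgrow : ∀ a s,
      total (enc (step a s)) ≤ total (enc s) + c.eval (total (inp a))) :
    PolyComp inp fun a => (step a)^[n a] (init a) := by
  have hw : PolyComp inp fun a => unary (n a) := hn.congr fun a => rfl
  have := fold (step := fun a _ s => step a s) hw hinit hstep c fun a _ s => hgrow a s
  refine this.congr fun a => ?_
  rw [List.foldl_const]
  simp [unary]

/-! ### Words and Boolean values -/

theorem revAppend {u v : α → List Letter} (hu : PolyComp inp u) (hv : PolyComp inp v) :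
    PolyComp inp fun a => (u a).reverse ++ v a := by
  refine comp₂ (F := fun u v : List Letter => u.reverse ++ v) ?_ hu hv
  have h : Computes (fun p : List Letter × List Letter => [p.1, p.2])
      fun p => [[], p.1.reverse ++ p.2] := by
    refine ⟨move 0 1, 5 * Polynomial.X + 1, 2, fun p =>
      ⟨below_initial le_rfl, below_initial le_rfl, ?_⟩⟩
    obtain ⟨t, h1, h2⟩ := runs_move zero_ne_one p.1 (initial [p.1, p.2]) rfl
    refine ⟨t, h2.cast ?_, h1.trans ?_⟩
    · funext i
      rcases i with _ | _ | i <;> simp [initial]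
      rfl
    · simp only [size_initial (show [p.1, p.2].length ≤ 2 from le_rfl)]
      simp
  exact h.trans (Computes.select (hb := ⟨2, fun _ => le_rfl⟩) [1])

theorem reverse [Bounded inp] {u : α → List Letter} (hu : PolyComp inp u) :
    PolyComp inp fun a => (u a).reverse :=
  (hu.revAppend (const [])).congr fun a => by simp

theorem append [Bounded inp] {u v : α → List Letter} (hu : PolyComp inp u)
    (hv : PolyComp inp v) : PolyComp inp fun a => u a ++ v a :=
  (hu.reverse.revAppend hv).congr fun a => by simp

theorem tail {u : α → List Letter} (hu : PolyComp inp u) : PolyComp inp fun a => (u a).tail :=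
  comp (F := List.tail)
    (computes_tail (hb := ⟨0, fun _ => le_rfl⟩) (fun _ => []) fun w : List Letter => w) hu

theorem ite [Bounded inp] {c : α → Bool} {f g : α → β} (hc : PolyComp inp c)
    (hf : PolyComp inp f) (hg : PolyComp inp g) :
    PolyComp inp fun a => if c a then f a else g a := by
  have h0 : Computes inp fun a => enc (c a) ++ inp a := by
    obtain ⟨K, hK⟩ := (inferInstance : Bounded inp).exists_le
    exact Computes.append hc (Transforms.refl fun a => below_initial (hK a)) fun _ => rfl
  refine h0.trans ?_
  have h1 : Computes (fun a => enc (c a) ++ inp a) inp := Computes.drop fun a => length_enc _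
  have h2 := Transforms.ite (some true) (h1.trans hf) (h1.trans hg)
  unfold Computes
  convert h2 using 2 with a
  have h3 : initial (enc (c a) ++ inp a) 0 = [some (c a)] := rfl
  simp only [h3]
  cases h : c a <;> simp

theorem bool₁ [Bounded inp] (F : Bool → β) {c : α → Bool} (hc : PolyComp inp c) :
    PolyComp inp fun a => F (c a) :=
  (hc.ite (const (F true)) (const (F false))).congr fun a => by cases c a <;> simp

theorem bool₂ [Bounded inp] (F : Bool → Bool → β) {c d : α → Bool} (hc : PolyComp inp c)
    (hd : PolyComp inp d) : PolyComp inp fun a => F (c a) (d a) :=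
  (hc.ite (hd.bool₁ (F true)) (hd.bool₁ (F false))).congr fun a => by cases c a <;> simp

theorem bool₃ [Bounded inp] (F : Bool → Bool → Bool → β) {c d e : α → Bool}
    (hc : PolyComp inp c) (hd : PolyComp inp d) (he : PolyComp inp e) :
    PolyComp inp fun a => F (c a) (d a) (e a) :=
  (hc.ite (hd.bool₂ (F true) he) (hd.bool₂ (F false) he)).congr fun a => by
    cases c a <;> simp

theorem headEq (l : Letter) {u : α → List Letter} (hu : PolyComp inp u) :
    PolyComp inp fun a => decide ((u a).head? = some l) := by
  refine comp (F := fun w : List Letter => decide (w.head? = some l)) ?_ hu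
  have h1 := Transforms.ite l (const (inp := (enc : List Letter → _)) true)
    (const (inp := (enc : List Letter → _)) false)
  unfold PolyFun PolyComp Computes
  convert h1 using 2 with w
  have h3 : initial (enc w) 0 = w := rfl
  rw [h3]
  by_cases h : w.head? = some l <;> simp [h]

theorem isEmpty [Bounded inp] {u : α → List Letter} (hu : PolyComp inp u) :
    PolyComp inp fun a => (u a).isEmpty :=
  ((hu.headEq none).bool₃ (fun c d e => !(c || d || e)) (hu.headEq (some true))
    (hu.headEq (some false))).congr fun a => by
      rcases u a with _ | ⟨_ | _ | _, _⟩ <;> simp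

/-! ### Natural numbers in unary -/

theorem codeNat {n : α → ℕ} (hn : PolyComp inp n) : PolyComp inp fun a => unary (n a) :=
  hn.congr fun _ => rfl

theorem add [Bounded inp] {m n : α → ℕ} (hm : PolyComp inp m) (hn : PolyComp inp n) :
    PolyComp inp fun a => m a + n a :=
  (hm.codeNat.append hn.codeNat).congr fun a => by simp [enc_nat, enc_letters, unary]

theorem length [Bounded inp] {u : α → List Letter} (hu : PolyComp inp u) :
    PolyComp inp fun a => (u a).length := by
  have := fold (S := ℕ) (step := fun _ _ s => s + 1) hu (const 0)
    (state.add (const 1)) 1 fun a l s => by simp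
  exact this.congr fun a => by simp [List.foldl_const]

theorem drop [Bounded inp] {n : α → ℕ} {u : α → List Letter} (hn : PolyComp inp n)
    (hu : PolyComp inp u) : PolyComp inp fun a => (u a).drop (n a) := by
  have := iterate (step := fun _ => List.tail) hn hu state.tail 0 fun a s => by simp
  exact this.congr fun a => by rw [iterate_tail]

theorem sub [Bounded inp] {m n : α → ℕ} (hm : PolyComp inp m) (hn : PolyComp inp n) :
    PolyComp inp fun a => m a - n a :=
  (hn.drop hm.codeNat).congr fun a => by simp [enc_nat, enc_letters, unary]

theorem mul [Bounded inp] {m n : α → ℕ} (hm : PolyComp inp m) (hn : PolyComp inp n) :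
    PolyComp inp fun a => m a * n a := by
  obtain ⟨b, hb⟩ := hn.exists_bound
  have := iterate (step := fun a s => s + n a) hm (const 0) (state.add hn.input) b fun a s => by
    simpa using hb a
  refine this.congr fun a => ?_
  congr 1
  induction m a with
  | zero => simp
  | succ k ih => rw [Function.iterate_succ_apply', ← ih, Nat.succ_mul]

theorem eqZero [Bounded inp] {n : α → ℕ} (hn : PolyComp inp n) :
    PolyComp inp fun a => decide (n a = 0) :=
  hn.codeNat.isEmpty.congr fun a => by cases n a <;> simp [unary]

theorem polynomial [Bounded inp] {n : α → ℕ} (hn : PolyComp inp n) (b : Polynomial ℕ) :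
    PolyComp inp fun a => b.eval (n a) := by
  induction b using Polynomial.induction_on with
  | C c => simpa using const c
  | add p q hp hq => simpa using hp.add hq
  | monomial k c h => exact (h.mul hn).congr fun a => by simp [pow_succ, mul_assoc]

end PolyComp

end Machine

namespace Machine

open Coded

variable {α β γ δ S : Type}

/-! ### Bit strings and lists of messages -/

@[simp] theorem length_word (l : List Bool) : (word l).length = l.length := by simp [word]

@[simp] theorem words_nil : words [] = [] := rfl

@[simp] theorem words_cons (m : List Bool) (h : List (List Bool)) :
    words (m :: h) = word m ++ none :: words h := by simp [words]

@[simp] theorem words_append (h h' : List (List Bool)) :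
    words (h ++ h') = words h ++ words h' := by simp [words]

/-- A step in the computation of an initial part of a word that is read letter by letter: the state
consists of the number of units that are still to be taken, and of the part found so far, in
reverse. A unit ends with a letter on which `t` holds. -/
def takeStep (t : Letter → Bool) (s : ℕ × List Letter) (l : Letter) : ℕ × List Letter :=
  if s.1 = 0 then s else (if t l then s.1 - 1 else s.1, l :: s.2)

/-- A step in the computation of the rest of a word, after a number of units to be dropped. -/
def dropStep (t : Letter → Bool) (s : ℕ × List Letter) (l : Letter) : ℕ × List Letter :=
  if s.1 = 0 then (0, l :: s.2) else (if t l then s.1 - 1 else s.1, s.2)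

theorem foldl_takeStep_zero (t : Letter → Bool) (w acc : List Letter) :
    w.foldl (takeStep t) (0, acc) = (0, acc) := by
  induction w with
  | nil => rfl
  | cons l w ih => simpa [takeStep] using ih

theorem foldl_dropStep_zero (t : Letter → Bool) (w acc : List Letter) :
    w.foldl (dropStep t) (0, acc) = (0, w.reverse ++ acc) := by
  induction w generalizing acc with
  | nil => rfl
  | cons l w ih => simpa [dropStep] using ih (l :: acc)

theorem foldl_takeStep_letters (n : ℕ) (w acc : List Letter) :
    (w.foldl (takeStep fun _ => true) (n, acc)).2 = (w.take n).reverse ++ acc := by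
  induction w generalizing n acc with
  | nil => simp
  | cons l w ih =>
    rcases n with _ | n
    · rw [foldl_takeStep_zero]; simp
    · simpa [takeStep] using ih n (l :: acc)

theorem foldl_takeStep_word (n : ℕ) (m : List Bool) (acc : List Letter) :
    (word m ++ [none]).foldl (takeStep Option.isNone) (n + 1, acc) =
      (n, (word m ++ [none]).reverse ++ acc) := by
  induction m generalizing acc with
  | nil => simp [takeStep, word]
  | cons b m ih => simpa [takeStep, word] using ih (some b :: acc)

theorem foldl_dropStep_word (n : ℕ) (m : List Bool) (acc : List Letter) :
    (word m ++ [none]).foldl (dropStep Option.isNone) (n + 1, acc) = (n, acc) := by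
  induction m generalizing acc with
  | nil => simp [dropStep, word]
  | cons b m ih => simpa [dropStep, word] using ih acc

theorem foldl_takeStep_words (n : ℕ) (h : List (List Bool)) (acc : List Letter) :
    ((words h).foldl (takeStep Option.isNone) (n, acc)).2 = (words (h.take n)).reverse ++ acc := by
  induction h generalizing n acc with
  | nil => simp
  | cons m h ih =>
    rcases n with _ | n
    · rw [foldl_takeStep_zero]; simp
    · have e : words (m :: h) = (word m ++ [none]) ++ words h := by simp
      rw [e, List.foldl_append, foldl_takeStep_word, ih]
      simp

theorem foldl_dropStep_words (n : ℕ) (h : List (List Bool)) (acc : List Letter) :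
    ((words h).foldl (dropStep Option.isNone) (n, acc)).2 = (words (h.drop n)).reverse ++ acc := by
  induction h generalizing n acc with
  | nil => simp
  | cons m h ih =>
    rcases n with _ | n
    · rw [foldl_dropStep_zero]; simp
    · have e : words (m :: h) = (word m ++ [none]) ++ words h := by simp
      rw [e, List.foldl_append, foldl_dropStep_word, ih]
      simp

namespace PolyComp

variable {inp : α → List (List Letter)}

theorem codeBits {u : α → List Bool} (hu : PolyComp inp u) : PolyComp inp fun a => word (u a) :=
  hu.congr fun _ => rfl

theorem codeMessages {h : α → List (List Bool)} (hh : PolyComp inp h) :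
    PolyComp inp fun a => words (h a) := hh.congr fun _ => rfl

theorem tailBits {u : α → List Bool} (hu : PolyComp inp u) : PolyComp inp fun a => (u a).tail :=
  hu.codeBits.tail.congr fun a => by simp [enc_bits, enc_letters, word]

theorem headBit {u : α → List Bool} (hu : PolyComp inp u) :
    PolyComp inp fun a => (u a).headD false :=
  (hu.codeBits.headEq (some true)).congr fun a => by
    rcases u a with _ | ⟨_ | _, _⟩ <;> simp [word]

variable [Bounded inp]

theorem foldTakeStep {t : Letter → Bool} (ht : PolyFun fun l : List Letter => l.head?.any t)
    {n : α → ℕ} {u : α → List Letter} (hn : PolyComp inp n) (hu : PolyComp inp u) :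
    PolyComp inp fun a => ((u a).foldl (takeStep t) (n a, [])).2 := by
  refine (fold (step := fun _ l s => takeStep t s l) hu (hn.pair (const [])) ?_ 1
    fun a l s => ?_).snd
  · have h1 : PolyComp (foldContext inp (enc : ℕ × List Letter → _)) fun q => q.2.2.1 :=
      state.fst
    refine (h1.eqZero.ite state (((comp ht letter).ite (h1.sub (const 1)) h1).pair
      (letter.append state.snd))).congr fun q => ?_
    by_cases h : q.2.2.1 = 0 <;> cases h' : t q.2.1 <;> simp [takeStep, h, h']
  · simp only [takeStep]
    split_ifs <;> simp <;> omega

theorem foldDropStep {t : Letter → Bool} (ht : PolyFun fun l : List Letter => l.head?.any t)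
    {n : α → ℕ} {u : α → List Letter} (hn : PolyComp inp n) (hu : PolyComp inp u) :
    PolyComp inp fun a => ((u a).foldl (dropStep t) (n a, [])).2 := by
  refine (fold (step := fun _ l s => dropStep t s l) hu (hn.pair (const [])) ?_ 1
    fun a l s => ?_).snd
  · have h1 : PolyComp (foldContext inp (enc : ℕ × List Letter → _)) fun q => q.2.2.1 :=
      state.fst
    refine (h1.eqZero.ite ((const 0).pair (letter.append state.snd))
      (((comp ht letter).ite (h1.sub (const 1)) h1).pair state.snd)).congr fun q => ?_
    by_cases h : q.2.2.1 = 0 <;> cases h' : t q.2.1 <;> simp [dropStep, h, h']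
  · simp only [dropStep]
    split_ifs <;> simp_all
    omega

theorem anyIsNone : PolyFun fun l : List Letter => l.head?.any Option.isNone :=
  (headEq none id).congr fun l => by rcases l with _ | ⟨_ | _, _⟩ <;> simp

theorem takeLetters {n : α → ℕ} {u : α → List Letter} (hn : PolyComp inp n)
    (hu : PolyComp inp u) : PolyComp inp fun a => (u a).take (n a) := by
  have ht : PolyFun fun l : List Letter => l.head?.any fun _ => true :=
    ((id.isEmpty).bool₁ not).congr fun l => by rcases l with _ | ⟨_, _⟩ <;> simp
  exact (foldTakeStep ht hn hu).reverse.congr fun a => by rw [foldl_takeStep_letters]; simp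

theorem takeBits {n : α → ℕ} {u : α → List Bool} (hn : PolyComp inp n)
    (hu : PolyComp inp u) : PolyComp inp fun a => (u a).take (n a) :=
  (hn.takeLetters hu.codeBits).congr fun a => by simp [enc_bits, enc_letters, word]

theorem dropBits {n : α → ℕ} {u : α → List Bool} (hn : PolyComp inp n)
    (hu : PolyComp inp u) : PolyComp inp fun a => (u a).drop (n a) :=
  (hn.drop hu.codeBits).congr fun a => by simp [enc_bits, enc_letters, word]

theorem consBit {b : α → Bool} {u : α → List Bool} (hb : PolyComp inp b) (hu : PolyComp inp u) :
    PolyComp inp fun a => b a :: u a := by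
  have h : PolyComp inp fun a => word [b a] := hb.congr fun _ => rfl
  exact (h.append hu.codeBits).congr fun a => by simp [enc_bits, enc_letters, word]

theorem appendBits {u v : α → List Bool} (hu : PolyComp inp u) (hv : PolyComp inp v) :
    PolyComp inp fun a => u a ++ v a :=
  (hu.codeBits.append hv.codeBits).congr fun a => by simp [enc_bits, enc_letters, word]

theorem reverseBits {u : α → List Bool} (hu : PolyComp inp u) :
    PolyComp inp fun a => (u a).reverse :=
  hu.codeBits.reverse.congr fun a => by simp [enc_bits, enc_letters, word]

theorem lengthBits {u : α → List Bool} (hu : PolyComp inp u) :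
    PolyComp inp fun a => (u a).length :=
  hu.codeBits.length.congr fun a => by simp

theorem takeMessages {n : α → ℕ} {h : α → List (List Bool)} (hn : PolyComp inp n)
    (hh : PolyComp inp h) : PolyComp inp fun a => (h a).take (n a) :=
  (foldTakeStep anyIsNone hn hh.codeMessages).reverse.congr fun a => by
    rw [foldl_takeStep_words]; simp [enc_messages, enc_letters]

theorem dropMessages {n : α → ℕ} {h : α → List (List Bool)} (hn : PolyComp inp n)
    (hh : PolyComp inp h) : PolyComp inp fun a => (h a).drop (n a) :=
  (foldDropStep anyIsNone hn hh.codeMessages).reverse.congr fun a => by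
    rw [foldl_dropStep_words]; simp [enc_messages, enc_letters]

theorem headMessage {h : α → List (List Bool)} (hh : PolyComp inp h) :
    PolyComp inp fun a => (h a).headD [] :=
  ((const 1).takeMessages hh).codeMessages.reverse.tail.reverse.congr fun a => by
    rcases h a with _ | ⟨_, _⟩ <;> simp [enc_bits, enc_letters, word]

end PolyComp

/-! ### Numbers in binary -/

/-- The number with the given binary digits, the least significant digit first. -/
def binVal : List Bool → ℕ
  | [] => 0
  | b :: l => b.toNat + 2 * binVal l

theorem binVal_bits (n : ℕ) : binVal n.bits = n := by
  induction n using Nat.binaryRec' with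
  | zero => simp [binVal]
  | bit b n h ih => rw [Nat.bits_append_bit _ _ h, binVal, ih, Nat.bit_val]; ring

theorem binVal_append_replicate (l : List Bool) (n : ℕ) :
    binVal (l ++ List.replicate n false) = binVal l := by
  induction l with
  | nil =>
    induction n with
    | zero => rfl
    | succ n ih => simpa [List.replicate_succ, binVal] using ih
  | cons b l ih => simp [binVal, ih]

/-- A step of subtraction with borrow: the state consists of the remaining digits of the
subtrahend, the borrow, and the digits of the difference in reverse; `x` is the next digit of the
minuend. -/
def subStep (s : List Bool × Bool × List Bool) (x : Bool) : List Bool × Bool × List Bool :=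
  (s.1.tail, bif x then s.1.headD false && s.2.1 else s.1.headD false || s.2.1,
    (x ^^ s.1.headD false ^^ s.2.1) :: s.2.2)

/-- The result of the subtraction steps, up to the borrow: no information is lost as long as the
minuend is not shorter than the subtrahend. -/
theorem foldl_subStep (x y : List Bool) (c : Bool) (out : List Bool) (h : y.length ≤ x.length) :
    ∃ (c' : Bool) (d : List Bool),
      x.foldl subStep (y, c, out) = ([], c', d.reverse ++ out) ∧ d.length = x.length ∧
      binVal x + 2 ^ x.length * c'.toNat = binVal y + c.toNat + binVal d := by
  induction x generalizing y c out with
  | nil =>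
    obtain rfl : y = [] := by simpa using h
    exact ⟨c, [], by simp, rfl, by simp [binVal]⟩
  | cons b x ih =>
    obtain ⟨c', d, h1, h2, h3⟩ := ih y.tail
      (bif b then y.headD false && c else y.headD false || c)
      ((b ^^ y.headD false ^^ c) :: out) (by simp at h ⊢; omega)
    refine ⟨c', (b ^^ y.headD false ^^ c) :: d, ?_, by simp [h2], ?_⟩
    · simpa [subStep] using h1
    · have h4 : binVal y = (y.headD false).toNat + 2 * binVal y.tail := by
        cases y <;> simp [binVal]
      rw [h4]
      simp only [binVal, List.length_cons, pow_succ]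
      generalize y.headD false = e at *
      cases b <;> cases e <;> cases c <;> simp at h3 ⊢ <;> linarith

/-- Subtraction of numbers in binary: the borrow at the end, and the difference. -/
def binSub (x y : List Bool) : Bool × List Bool :=
  let s := (x ++ List.replicate y.length false).foldl subStep (y, false, [])
  (s.2.1, s.2.2.reverse)

theorem length_binSub (x y : List Bool) : (binSub x y).2.length = x.length + y.length := by
  obtain ⟨c', d, h1, h2, -⟩ := foldl_subStep (x ++ List.replicate y.length false) y false []
    (by simp)
  simp only [binSub, h1]
  simp [h2]

theorem binVal_lt (l : List Bool) : binVal l < 2 ^ l.length := by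
  induction l with
  | nil => simp [binVal]
  | cons b l ih =>
    simp only [binVal, List.length_cons, pow_succ]
    cases b <;> simp <;> omega

theorem binSub_fst (x y : List Bool) : (binSub x y).1 = decide (binVal x < binVal y) := by
  obtain ⟨c', d, h1, h2, h3⟩ := foldl_subStep (x ++ List.replicate y.length false) y false []
    (by simp)
  have h4 := binVal_lt d
  rw [binVal_append_replicate] at h3
  rw [h2] at h4
  simp only [binSub, h1]
  generalize 2 ^ (x ++ List.replicate y.length false).length = N at h3 h4
  cases c' <;> simp at h3 ⊢ <;> omega

theorem binVal_binSub (x y : List Bool) (h : binVal y ≤ binVal x) :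
    binVal (binSub x y).2 = binVal x - binVal y := by
  have h0 := binSub_fst x y
  obtain ⟨c', d, h1, h2, h3⟩ := foldl_subStep (x ++ List.replicate y.length false) y false []
    (by simp)
  rw [binVal_append_replicate] at h3
  simp only [binSub, h1] at h0 ⊢
  obtain rfl : c' = false := by simp [h0, h]
  simp at h3 ⊢
  omega

theorem PolyComp.binSub {inp : α → List (List Letter)} {x y : α → List Bool} (hx : PolyComp inp x) (hy : PolyComp inp y) :
    PolyComp inp fun a => binSub (x a) (y a) := by
  refine PolyComp.comp₂ (F := Machine.binSub) ?_ hx hy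
  have hx' : PolyFun (Prod.fst : List Bool × List Bool → List Bool) := .fst .id
  have hy' : PolyFun (Prod.snd : List Bool × List Bool → List Bool) := .snd .id
  have hz : PolyFun fun p : List Bool × List Bool => List.replicate p.2.length false :=
    (PolyComp.iterate (n := fun p : List Bool × List Bool => p.2.length) (step := fun _ l => false :: l)
      (init := fun _ => []) hy'.lengthBits (.const []) ((PolyComp.const false).consBit .state) 1
      fun p l => by simp).congr fun p => by
        congr 1
        induction p.2.length with
        | zero => rfl
        | succ n ih => rw [Function.iterate_succ_apply', ← ih, List.replicate_succ]
  have h1 : PolyComp (foldContext (enc : List Bool × List Bool → _)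
      (enc : List Bool × Bool × List Bool → _)) fun q => q.2.2.1 := PolyComp.state.fst
  have h2 : PolyComp (foldContext (enc : List Bool × List Bool → _)
      (enc : List Bool × Bool × List Bool → _)) fun q => q.2.2.2.1 := PolyComp.state.snd.fst
  have h3 : PolyComp (foldContext (enc : List Bool × List Bool → _)
      (enc : List Bool × Bool × List Bool → _)) fun q => q.2.2.2.2 := PolyComp.state.snd.snd
  have h4 : PolyComp (foldContext (enc : List Bool × List Bool → _)
      (enc : List Bool × Bool × List Bool → _)) fun q => decide (q.2.1 = some true) :=
    (PolyComp.letter.headEq (some true)).congr fun q => by simp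
  have hstep : PolyComp (foldContext (enc : List Bool × List Bool → _)
      (enc : List Bool × Bool × List Bool → _))
      fun q => subStep q.2.2 (decide (q.2.1 = some true)) :=
    h1.tailBits.pair ((h4.bool₃ (fun x y c => bif x then y && c else y || c) h1.headBit h2).pair
      ((h4.bool₃ (fun x y c => x ^^ y ^^ c) h1.headBit h2).consBit h3))
  have := PolyComp.fold (step := fun (_ : List Bool × List Bool) l s => subStep s (decide (l = some true)))
    (hx'.appendBits hz).codeBits (hy'.pair ((PolyComp.const false).pair (.const []))) hstep 1
    fun p l s => by simp [subStep]; omega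
  refine (this.snd.fst.pair this.snd.snd.reverseBits).congr fun p => ?_
  have e : ∀ (w : List Bool) (s : List Bool × Bool × List Bool),
      (word w).foldl (fun s l => subStep s (decide (l = some true))) s = w.foldl subStep s := by
    intro w s
    rw [word, List.foldl_map]
    simp
  rw [e]
  rfl

/-- An experiment with fair coins that succeeds with probability about `v = a / b`. Each coin
replaces `v` by `2 * v` or by `2 * v - 1`, truncated at `0`. This preserves the mean of `v` truncated
to `[0, 1]`, and values `v ≥ 1` as well as `v = 0` persist. -/
def bernoulli (a b : ℕ) : List Bool → Bool
  | [] => decide (b ≤ a)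
  | c :: l => bernoulli (if c then 2 * a - b else 2 * a) b l

/-- A step of the experiment, for the numerator in binary. -/
def bernoulliStep (b : List Bool) (c : Bool) (a : List Bool) : List Bool :=
  if c then (if (binSub (false :: a) b).1 then [] else (binSub (false :: a) b).2) else false :: a

theorem binVal_bernoulliStep (b : List Bool) (c : Bool) (a : List Bool) :
    binVal (bernoulliStep b c a) = if c then 2 * binVal a - binVal b else 2 * binVal a := by
  have h1 : binVal (false :: a) = 2 * binVal a := by simp [binVal]
  unfold bernoulliStep
  split_ifs with hc h
  · rw [binSub_fst, h1, decide_eq_true_eq] at h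
    simp [binVal]; omega
  · rw [binSub_fst, h1, decide_eq_true_eq] at h
    rw [binVal_binSub _ _ (by omega), h1]
  · exact h1

theorem PolyComp.bernoulli {inp : α → List (List Letter)} [Bounded inp] {x y l : α → List Bool}
    (hx : PolyComp inp x) (hy : PolyComp inp y) (hl : PolyComp inp l) :
    PolyComp inp fun a => bernoulli (binVal (x a)) (binVal (y a)) (l a) := by
  obtain ⟨b, hb⟩ := hy.exists_bound
  have hc : PolyComp (foldContext inp (enc : List Bool → _)) fun q => decide (q.2.1 = some true) :=
    (PolyComp.letter.headEq (some true)).congr fun q => by simp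
  have hs : PolyComp (foldContext inp (enc : List Bool → _)) fun q =>
      Machine.binSub (false :: q.2.2) (y q.1) := ((PolyComp.const false).consBit .state).binSub hy.input
  have hstep : PolyComp (foldContext inp (enc : List Bool → _)) fun q =>
      bernoulliStep (y q.1) (decide (q.2.1 = some true)) q.2.2 :=
    hc.ite (hs.fst.ite (.const []) hs.snd) ((PolyComp.const false).consBit .state)
  have h1 := PolyComp.fold (step := fun a l s => bernoulliStep (y a) (decide (l = some true)) s)
    hl.codeBits hx hstep (b + 1) fun a l s => by
      have h2 := hb a
      have h3 := length_binSub (false :: s) (y a)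
      simp only [total_enc_bits, Polynomial.eval_add, Polynomial.eval_one, bernoulliStep,
        List.length_cons] at h2 h3 ⊢
      split_ifs
      · simp
      · rw [h3]; omega
      · simp
  refine ((h1.binSub hy).fst.bool₁ not).congr fun a => ?_
  congr 1
  rw [word, List.foldl_map, binSub_fst]
  generalize x a = u
  induction l a generalizing u with
  | nil => rcases lt_or_ge (binVal u) (binVal (y a)) with h | h <;> simp [Machine.bernoulli, h]
  | cons c l ih =>
    rw [Machine.bernoulli, ← binVal_bernoulliStep, ih]
    simp

end Machine

namespace InteractiveProof

/-! ### Averages over coin tosses -/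

/-- The expectation of a quantity that depends on `m` fair coins. -/
noncomputable def coinAvg (m : ℕ) (f : List Bool → ℝ) : ℝ :=
  (∑ r : Fin m → Bool, f (List.ofFn r)) / 2 ^ m

theorem coinAvg_mono {m : ℕ} {f g : List Bool → ℝ} (h : ∀ r, r.length = m → f r ≤ g r) :
    coinAvg m f ≤ coinAvg m g :=
  div_le_div_of_nonneg_right (Finset.sum_le_sum fun r _ => h _ (by simp)) (by positivity)

theorem coinAvg_congr {m : ℕ} {f g : List Bool → ℝ} (h : ∀ r, r.length = m → f r = g r) :
    coinAvg m f = coinAvg m g :=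
  le_antisymm (coinAvg_mono fun r hr => (h r hr).le) (coinAvg_mono fun r hr => (h r hr).ge)

theorem coinAvg_const (m : ℕ) (c : ℝ) : (coinAvg m fun _ => c) = c := by
  simp [coinAvg]

theorem coinAvg_add (m : ℕ) (f g : List Bool → ℝ) :
    (coinAvg m fun r => f r + g r) = coinAvg m f + coinAvg m g := by
  simp [coinAvg, Finset.sum_add_distrib, add_div]

theorem coinAvg_const_mul (m : ℕ) (c : ℝ) (f : List Bool → ℝ) :
    (coinAvg m fun r => c * f r) = c * coinAvg m f := by
  simp [coinAvg, ← Finset.mul_sum, mul_div_assoc]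

theorem coinAvg_sub (m : ℕ) (f g : List Bool → ℝ) :
    (coinAvg m fun r => f r - g r) = coinAvg m f - coinAvg m g := by
  simp [coinAvg, Finset.sum_sub_distrib, sub_div]

/-- Coins that are tossed in two lots. -/
theorem coinAvg_append (m n : ℕ) (f : List Bool → ℝ) :
    coinAvg (m + n) f = coinAvg m fun r => coinAvg n fun r' => f (r ++ r') := by
  have h : ∑ r : Fin (m + n) → Bool, f (List.ofFn r) =
      ∑ r : Fin m → Bool, ∑ r' : Fin n → Bool, f (List.ofFn r ++ List.ofFn r') := by
    rw [← Fintype.sum_prod_type', ← (Fin.appendEquiv m n).sum_comp]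
    exact Finset.sum_congr rfl fun p _ => by simp [Fin.appendEquiv, List.ofFn_fin_append]
  simp only [coinAvg, h, ← Finset.sum_div]
  rw [div_div, pow_add, mul_comm]

theorem coinAvg_one (f : List Bool → ℝ) : coinAvg 1 f = (f [true] + f [false]) / 2 := by
  unfold coinAvg
  rw [← (Equiv.funUnique (Fin 1) Bool).symm.sum_comp]
  simp

theorem coinAvg_zero (f : List Bool → ℝ) : coinAvg 0 f = f [] := by
  simp [coinAvg]

theorem coinAvg_succ (m : ℕ) (f : List Bool → ℝ) :
    coinAvg (m + 1) f = ((coinAvg m fun r => f (true :: r)) + coinAvg m fun r => f (false :: r)) / 2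
    := by
  rw [add_comm, coinAvg_append, coinAvg_one]
  rfl

theorem coinAvg_nonneg {m : ℕ} {f : List Bool → ℝ} (h : ∀ r, 0 ≤ f r) : 0 ≤ coinAvg m f :=
  (coinAvg_const m 0).ge.trans (coinAvg_mono fun r _ => h r)

theorem coinAvg_le_one {m : ℕ} {f : List Bool → ℝ} (h : ∀ r, f r ≤ 1) : coinAvg m f ≤ 1 :=
  (coinAvg_mono fun r _ => h r).trans (coinAvg_const m 1).le

/-- The second moment of the positive part of a sum of increments with values in `[-1, 1]`, each of
which has nonpositive mean, given the coins of the earlier increments. -/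
theorem coinAvg_sq_posPart_sum_le (ρ : ℕ) (Z : ℕ → List Bool → ℝ)
    (hloc : ∀ i j r r', r.length = j * ρ → i < j → Z i (r ++ r') = Z i r)
    (hone : ∀ j r, |Z j r| ≤ 1)
    (hmean : ∀ j r, r.length = j * ρ → (coinAvg ρ fun r' => Z j (r ++ r')) ≤ 0) (N : ℕ) :
    (coinAvg (N * ρ) fun r => (max 0 (∑ i ∈ Finset.range N, Z i r)) ^ 2) ≤ N := by
  induction N with
  | zero => simp [coinAvg]
  | succ N ih =>
    rw [Nat.succ_mul, coinAvg_append]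
    refine (coinAvg_mono (g := fun r =>
      (max 0 (∑ i ∈ Finset.range N, Z i r)) ^ 2 + 1) fun r hr => ?_).trans ?_
    · set S := ∑ i ∈ Finset.range N, Z i r with hS
      have h1 : ∀ r', ∑ i ∈ Finset.range (N + 1), Z i (r ++ r') = S + Z N (r ++ r') := by
        intro r'
        rw [Finset.sum_range_succ, hS]
        congr 1
        exact Finset.sum_congr rfl fun i hi => hloc i N r r' hr (Finset.mem_range.1 hi)
      -- `(s + z)₊² ≤ s₊² + 2 s₊ z + z²`, and the linear term has nonpositive mean.
      have h2 : ∀ r', (max 0 (S + Z N (r ++ r'))) ^ 2 ≤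
          ((max 0 S) ^ 2 + 1) + 2 * max 0 S * Z N (r ++ r') := by
        intro r'
        have hz := abs_le.1 (hone N (r ++ r'))
        generalize Z N (r ++ r') = z at *
        have hz2 : z ^ 2 ≤ 1 := by nlinarith
        rcases max_cases 0 S with ⟨e, h⟩ | ⟨e, h⟩ <;>
          rcases max_cases 0 (S + z) with ⟨e', h'⟩ | ⟨e', h'⟩ <;> rw [e, e'] <;> nlinarith
      simp only [h1]
      refine (coinAvg_mono fun r' _ => h2 r').trans ?_
      rw [coinAvg_add, coinAvg_const, coinAvg_const_mul]
      have := hmean N r hr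
      have h3 : 0 ≤ 2 * max 0 S := by positivity
      nlinarith
    · rw [coinAvg_add, coinAvg_const]
      push_cast
      linarith

/-- Chebyshev's inequality for such a sum. -/
theorem coinAvg_deviation_le (ρ : ℕ) (Z : ℕ → List Bool → ℝ)
    (hloc : ∀ i j r r', r.length = j * ρ → i < j → Z i (r ++ r') = Z i r)
    (hone : ∀ j r, |Z j r| ≤ 1)
    (hmean : ∀ j r, r.length = j * ρ → (coinAvg ρ fun r' => Z j (r ++ r')) ≤ 0) {N : ℕ}
    (hN : 0 < N) {d : ℝ} (hd : 0 < d) {f : List Bool → ℝ} (hf : ∀ r, f r ≤ 1)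
    (hfd : ∀ r, r.length = N * ρ → 0 < f r → N * d ≤ ∑ i ∈ Finset.range N, Z i r) :
    coinAvg (N * ρ) f ≤ 1 / (N * d ^ 2) := by
  have hN' : (0 : ℝ) < N := by exact_mod_cast hN
  have h1 : coinAvg (N * ρ) f ≤ coinAvg (N * ρ) fun r =>
      1 / (N * d) ^ 2 * (max 0 (∑ i ∈ Finset.range N, Z i r)) ^ 2 := by
    refine coinAvg_mono fun r hr => ?_
    by_cases h : 0 < f r
    · have h2 := hfd r hr h
      have h3 : (N * d) ^ 2 ≤ (max 0 (∑ i ∈ Finset.range N, Z i r)) ^ 2 :=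
        pow_le_pow_left₀ (by positivity) (h2.trans (le_max_right _ _)) 2
      rw [one_div, inv_mul_eq_div]
      exact (hf r).trans ((one_le_div (by positivity)).2 h3)
    · exact (not_lt.1 h).trans (by positivity)
  refine h1.trans ?_
  rw [coinAvg_const_mul]
  calc _ ≤ 1 / (N * d) ^ 2 * (N : ℝ) := by
        gcongr
        exact coinAvg_sq_posPart_sum_le ρ Z hloc hone hmean N
    _ = _ := by field_simp

/-! ### Simulating a biased coin -/

open Machine in
/-- The success probability of the experiment `bernoulli a b` with `m` coins. -/
noncomputable def bernoulliProb (m a b : ℕ) : ℝ :=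
  coinAvg m fun l => if bernoulli a b l = true then 1 else 0

theorem bernoulliProb_succ (m a b : ℕ) :
    bernoulliProb (m + 1) a b = (bernoulliProb m (2 * a - b) b + bernoulliProb m (2 * a) b) / 2 := by
  simp [bernoulliProb, coinAvg_succ, Machine.bernoulli]

theorem bernoulliProb_zero (a b : ℕ) : bernoulliProb 0 a b = if b ≤ a then 1 else 0 := by
  simp [bernoulliProb, coinAvg_zero, Machine.bernoulli]

theorem bernoulliProb_of_le (m : ℕ) {a b : ℕ} (h : b ≤ a) : bernoulliProb m a b = 1 := by
  induction m generalizing a with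
  | zero => simp [bernoulliProb_zero, h]
  | succ m ih => rw [bernoulliProb_succ, ih (by omega), ih (by omega)]; norm_num

theorem bernoulliProb_zero_left (m : ℕ) {b : ℕ} (hb : 0 < b) : bernoulliProb m 0 b = 0 := by
  induction m with
  | zero => simp [bernoulliProb_zero, hb.ne']
  | succ m ih =>
    rw [bernoulliProb_succ]
    simp [ih]

theorem bernoulliProb_bounds (m : ℕ) {a b : ℕ} (hb : 0 < b) (h : a ≤ b) :
    (a / b : ℝ) - 1 / 2 ^ m ≤ bernoulliProb m a b ∧ bernoulliProb m a b ≤ a / b := by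
  have hb' : (0 : ℝ) < b := by exact_mod_cast hb
  induction m generalizing a with
  | zero =>
    rw [bernoulliProb_zero]
    split_ifs with h1
    · obtain rfl : a = b := le_antisymm h h1
      simp [hb'.ne']
    · have h2 : (a : ℝ) ≤ b := by exact_mod_cast h
      have h3 : (a / b : ℝ) ≤ 1 := (div_le_one hb').2 h2
      have h4 : (0 : ℝ) ≤ a / b := by positivity
      constructor <;> simp [h3, h4]
  | succ m ih =>
    rw [bernoulliProb_succ]
    have e : (1 : ℝ) / 2 ^ (m + 1) = 1 / 2 ^ m / 2 := by rw [pow_succ]; field_simp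
    rw [e]
    -- One of the two outcomes of the coin decides the experiment.
    rcases le_total (2 * a) b with h1 | h1
    · rw [Nat.sub_eq_zero_of_le h1, bernoulliProb_zero_left m hb]
      obtain ⟨h2, h3⟩ := ih h1
      have e2 : (((2 * a : ℕ) : ℝ) / b) = 2 * (a / b) := by push_cast; ring
      rw [e2] at h2 h3
      constructor <;> linarith
    · rw [bernoulliProb_of_le m h1]
      obtain ⟨h2, h3⟩ := ih (a := 2 * a - b) (by omega)
      have e2 : (((2 * a - b : ℕ) : ℝ) / b) = 2 * (a / b) - 1 := by
        rw [Nat.cast_sub h1]; push_cast; field_simp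
      rw [e2] at h2 h3
      constructor <;> linarith

/-! ### The interaction in a protocol -/

namespace Protocol

variable {adv : ℕ → List Letter} (V : Protocol adv) (x r : List Bool) (s : Profile)

theorem length_play_fst (j : ℕ) :
    (V.play x r s j).1.length = j * V.numProvers x.length := by
  induction j with
  | zero => simp [play]
  | succ j ih => simp [play, ih, Nat.succ_mul]

theorem length_play_snd (j i : ℕ) : ((V.play x r s j).2 i).length = j := by
  induction j with
  | zero => simp [play]
  | succ j ih => simp [play, ih]

/-- The first `k` rounds depend only on the reactions of the provers to shorter transcripts. -/
theorem play_congr {s s' : Profile} {k : ℕ} (h : ∀ i tr, tr.length < k → s i tr = s' i tr) {j : ℕ}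
    (hj : j ≤ k) : V.play x r s j = V.play x r s' j := by
  induction j with
  | zero => rfl
  | succ j ih =>
    have h1 : ∀ i, s i ((V.play x r s' j).2 i) = s' i ((V.play x r s' j).2 i) := fun i =>
      h i _ (by rw [length_play_snd]; omega)
    simp only [play, ih (by omega), h1]

theorem length_le_of_mem_play (j : ℕ) :
    ∀ m ∈ (V.play x r s j).1, m.length ≤ V.msgLen x.length := by
  induction j with
  | zero => simp [play]
  | succ j ih =>
    intro m hm
    simp only [play, List.mem_append, List.mem_map] at hm
    rcases hm with hm | ⟨i, -, rfl⟩
    · exact ih m hm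
    · simp

/-- On a given input there are only finitely many transcripts. -/
theorem finite_transcripts : {h | ∃ r s, V.transcript x r s = h}.Finite := by
  have h1 : {m : List Bool | m.length ≤ V.msgLen x.length}.Finite := List.finite_length_le _ _
  have := h1.to_subtype
  refine ((List.finite_length_eq {m : List Bool | m.length ≤ V.msgLen x.length}
    (V.numRounds x.length * V.numProvers x.length)).image (List.map Subtype.val)).subset ?_
  rintro h ⟨r, s, rfl⟩
  refine ⟨(V.transcript x r s).attach.map fun m =>
    ⟨m.1, V.length_le_of_mem_play x r s _ m.1 m.2⟩, ?_, ?_⟩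
  · rw [Set.mem_ofPred_eq]
    simp [transcript, length_play_fst]
  · simp [Function.comp_def]

end Protocol

theorem RationalVerifier.exists_isOptimal (V : RationalVerifier) (x : List Bool) :
    ∃ s, V.IsOptimal x s := by
  have h1 : (Set.range fun s => fun r : Fin (V.numCoins x.length) → Bool =>
      V.transcript x (List.ofFn r) s).Finite := by
    refine (Set.Finite.pi fun _ : Fin (V.numCoins x.length) → Bool =>
      V.finite_transcripts x).subset ?_
    rintro _ ⟨s, rfl⟩ r -
    exact ⟨_, _, rfl⟩
  have h2 : (Set.range (V.expectedPayment x)).Finite := by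
    refine (h1.image fun t => (∑ r, (V.payment x (List.ofFn r) (t r) : ℝ)) /
      2 ^ V.numCoins x.length).subset ?_
    rintro _ ⟨s, rfl⟩
    exact ⟨_, ⟨s, rfl⟩, rfl⟩
  obtain ⟨_, ⟨s, rfl⟩, hs⟩ := Set.exists_max_image _ id h2 ⟨_, ⟨fun _ _ => [], rfl⟩⟩
  exact ⟨s, fun s' => hs _ ⟨s', rfl⟩⟩

end InteractiveProof

/-! ### Programs for verifiers -/

namespace Machine

open Coded InteractiveProof

variable {α : Type} {inp : α → List (List Letter)}

theorem PolyTimeUnary.polyFun {f : ℕ → ℕ} (hf : PolyTimeUnary f) : PolyFun f :=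
  PolyTimeComputable.computes hf (hb := ⟨1, fun _ => le_rfl⟩)

theorem PolyComp.polyTimeUnary {f : ℕ → ℕ} (hf : PolyFun f) : PolyTimeUnary f :=
  Computes.polyTimeComputable hf

theorem PolyTimeUnary.polyComp {f : ℕ → ℕ} (hf : PolyTimeUnary f) {n : α → ℕ}
    (hn : PolyComp inp n) : PolyComp inp fun a => f (n a) := hf.polyFun.comp hn

namespace PolyComp

theorem ratMessages {q : α → ℚ} (hq : PolyComp inp q) : PolyComp inp fun a =>
    ([[decide (q a < 0)], (q a).num.natAbs.bits, (q a).den.bits] : List (List Bool)) :=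
  hq.congr fun _ => rfl

variable [Bounded inp]

theorem lt {m n : α → ℕ} (hm : PolyComp inp m) (hn : PolyComp inp n) :
    PolyComp inp fun a => decide (m a < n a) :=
  ((hn.sub hm).eqZero.bool₁ not).congr fun a => by
    rcases lt_or_ge (m a) (n a) with h | h
    · have : n a - m a ≠ 0 := by omega
      simp [h, this]
    · simp [h, not_lt.2 h]

theorem div {m n : α → ℕ} (hm : PolyComp inp m) (hn : PolyComp inp n) (hpos : ∀ a, 0 < n a) :
    PolyComp inp fun a => m a / n a := by
  have h1 : PolyComp (foldContext inp (enc : ℕ × ℕ → _)) fun q => q.2.2.1 := state.fst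
  have h2 : PolyComp (foldContext inp (enc : ℕ × ℕ → _)) fun q => q.2.2.2 := state.snd
  have hstep : PolyComp (foldContext inp (enc : ℕ × ℕ → _)) fun q =>
      if decide (q.2.2.1 < n q.1) then q.2.2 else (q.2.2.1 - n q.1, q.2.2.2 + 1) :=
    (h1.lt hn.input).ite state ((h1.sub hn.input).pair (h2.add (const 1)))
  have h3 := iterate (step := fun a (s : ℕ × ℕ) =>
    if decide (s.1 < n a) then s else (s.1 - n a, s.2 + 1)) hm (hm.pair (const 0)) hstep 1
    fun a s => by split_ifs <;> simp; omega
  refine h3.snd.congr fun a => ?_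
  have key : ∀ k d q : ℕ, d ≤ k → ((fun s : ℕ × ℕ =>
      if decide (s.1 < n a) then s else (s.1 - n a, s.2 + 1))^[k] (d, q)).2 = q + d / n a := by
    intro k
    induction k with
    | zero =>
      intro d q hd
      obtain rfl : d = 0 := by omega
      simp
    | succ k ih =>
      intro d q hd
      have hp := hpos a
      rw [Function.iterate_succ_apply]
      by_cases h : d < n a
      · have h4 : ∀ j : ℕ, ((fun s : ℕ × ℕ =>
            if decide (s.1 < n a) then s else (s.1 - n a, s.2 + 1))^[j] (d, q)) = (d, q) := by
          intro j
          induction j with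
          | zero => rfl
          | succ j ih => rw [Function.iterate_succ_apply]; simpa [h] using ih
        simp only [h, decide_true, if_true]
        rw [h4, Nat.div_eq_of_lt h, add_zero]
      · simp only [h, decide_false, Bool.false_eq_true, if_false]
        rw [ih _ _ (by omega), Nat.div_eq_sub_div hp (not_lt.1 h)]
        omega
  rw [key _ _ _ le_rfl, zero_add]

theorem lengthMessages {h : α → List (List Bool)} (hh : PolyComp inp h) :
    PolyComp inp fun a => (h a).length := by
  have hstep : PolyComp (foldContext inp (enc : ℕ → _)) fun q =>
      if decide (q.2.1 = none) then q.2.2 + 1 else q.2.2 :=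
    ((letter.headEq none).ite (state.add (const 1)) state).congr fun q => by simp
  have h1 := fold (step := fun _ l (s : ℕ) => if decide (l = none) then s + 1 else s)
    hh.codeMessages (const 0) hstep 1 fun a l s => by split_ifs <;> simp
  refine h1.congr fun a => ?_
  congr 1
  have key : ∀ (g : List (List Bool)) (s : ℕ), (words g).foldl
      (fun s l => if decide (l = none) then s + 1 else s) s = s + g.length := by
    have hw : ∀ (m : List Bool) (s : ℕ),
        (word m).foldl (fun s l => if decide (l = none) then s + 1 else s) s = s := by
      intro m
      induction m with
      | nil => intro s; rfl
      | cons b m ih => intro s; simpa [word] using ih s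
    intro g
    induction g with
    | nil => intro s; rfl
    | cons m g ih =>
      intro s
      rw [words_cons, List.foldl_append, hw, List.foldl_cons, ih]
      simp
      omega
  rw [key, zero_add]

theorem ratNeg {q : α → ℚ} (hq : PolyComp inp q) : PolyComp inp fun a => decide (q a < 0) :=
  hq.ratMessages.headMessage.headBit

theorem ratNum {q : α → ℚ} (hq : PolyComp inp q) :
    PolyComp inp fun a => (q a).num.natAbs.bits :=
  ((const 1).dropMessages hq.ratMessages).headMessage

theorem ratDen {q : α → ℚ} (hq : PolyComp inp q) : PolyComp inp fun a => (q a).den.bits :=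
  ((const 2).dropMessages hq.ratMessages).headMessage

end PolyComp

/-! ### The input of a verifier -/

instance (adv : ℕ → List Letter) : Bounded (verifierInput adv) := ⟨4, fun _ => le_rfl⟩

namespace PolyComp

variable {adv : ℕ → List Letter}

theorem verifierString : PolyComp (verifierInput adv) fun a => a.1 :=
  get 0 fun a j hj => by obtain rfl : j = 0 := Nat.lt_one_iff.1 hj; rfl

theorem verifierCoins : PolyComp (verifierInput adv) fun a => a.2.1 :=
  get 1 fun a j hj => by obtain rfl : j = 0 := Nat.lt_one_iff.1 hj; rfl

theorem verifierMessages : PolyComp (verifierInput adv) fun a => a.2.2 :=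
  get 2 fun a j hj => by obtain rfl : j = 0 := Nat.lt_one_iff.1 hj; rfl

theorem verifierAdvice : PolyComp (verifierInput adv) fun a => adv a.1.length :=
  get 3 fun a j hj => by obtain rfl : j = 0 := Nat.lt_one_iff.1 hj; rfl

theorem noAdvice [Bounded inp] (n : α → ℕ) : PolyComp inp fun a => noAdvice (n a) := const []

/-- Running a part of a verifier on a string, coins and messages that have been computed. -/
theorem verifierCall {out : List Bool × List Bool × List (List Bool) → List Letter}
    (h : PolyTimeComputable (verifierInput adv) out) {x r : α → List Bool}
    {g : α → List (List Bool)} (hx : PolyComp inp x) (hr : PolyComp inp r) (hg : PolyComp inp g)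
    (hadv : PolyComp inp fun a => adv (x a).length) :
    Computes inp fun a => [out (x a, r a, g a)] := by
  have h1 : Computes inp fun a => verifierInput adv (x a, r a, g a) :=
    Computes.append hx (Computes.append hr (Computes.append hg hadv fun _ => rfl) fun _ => rfl)
      fun _ => rfl
  exact h1.trans (Computes.comp h.computes fun a => (x a, r a, g a))

end PolyComp

/-- A test that succeeds with probability about `(R + 1 - t) / 2`, for rational numbers `R` and `t`
in `[0, 1]`: the first coin decides whether the success of a coin with bias `R` or the failure of a
coin with bias `t` is wanted. If `t` is not in `[0, 1]`, then the comparison of `R` with `t` has a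
trivial outcome. -/
def thresholdTest (R t : ℚ) (c : List Bool) : Bool :=
  if t < 0 then true
  else if t.den < t.num.natAbs then false
  else if c.headD false then bernoulli R.num.natAbs R.den c.tail
  else !bernoulli t.num.natAbs t.den c.tail

theorem PolyComp.thresholdTest [Bounded inp] {R t : α → ℚ} {c : α → List Bool}
    (hR : PolyComp inp R) (ht : PolyComp inp t) (hc : PolyComp inp c) :
    PolyComp inp fun a => thresholdTest (R a) (t a) (c a) := by
  have h1 : PolyComp inp fun a => decide ((t a).den < (t a).num.natAbs) :=
    (ht.ratDen.binSub ht.ratNum).fst.congr fun a => by rw [binSub_fst, binVal_bits, binVal_bits]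
  have h2 := hR.ratNum.bernoulli hR.ratDen hc.tailBits
  have h3 := (ht.ratNum.bernoulli ht.ratDen hc.tailBits).bool₁ not
  refine (ht.ratNeg.ite (.const true) (h1.ite (.const false) (hc.headBit.ite h2 h3))).congr
    fun a => ?_
  simp only [binVal_bits, decide_eq_true_eq]
  rfl

end Machine

/-! ### From payments to acceptance -/

namespace InteractiveProof

open Machine

namespace RationalVerifier

variable {adv : ℕ → List Letter} (V : RationalVerifier) {θ : ℕ → ℚ} {m : ℕ → ℕ}

theorem payment_polyComp : PolyComp (verifierInput adv) fun a =>
    V.payment a.1 (a.2.1.take (V.numCoins a.1.length)) a.2.2 := by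
  have hr : PolyComp (verifierInput adv) fun a => a.2.1.take (V.numCoins a.1.length) :=
    (V.numCoins_poly.polyComp PolyComp.verifierString.lengthBits).takeBits .verifierCoins
  have h := PolyComp.verifierCall V.payment_poly .verifierString hr .verifierMessages (.noAdvice _)
  exact h

theorem threshold_polyComp
    (hθ : PolyTimeComputable (fun n => [unary n, adv n]) fun n => encodeRat (θ n)) :
    PolyComp (verifierInput adv) fun a => θ a.1.length := by
  have h1 : Computes (verifierInput adv) fun a => [unary a.1.length, adv a.1.length] :=
    Computes.append PolyComp.verifierString.lengthBits PolyComp.verifierAdvice fun _ => rfl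
  have h2 : Computes (fun n => [unary n, adv n]) fun n => [encodeRat (θ n)] :=
    hθ.computes (hb := ⟨2, fun _ => le_rfl⟩)
  exact h1.trans (h2.comp fun a : List Bool × List Bool × List (List Bool) => a.1.length)

theorem thresholdTest_polyComp
    (hθ : PolyTimeComputable (fun n => [unary n, adv n]) fun n => encodeRat (θ n)) :
    PolyComp (verifierInput adv) fun a =>
      thresholdTest (V.payment a.1 (a.2.1.take (V.numCoins a.1.length)) a.2.2) (θ a.1.length)
        (a.2.1.drop (V.numCoins a.1.length)) :=
  V.payment_polyComp.thresholdTest (threshold_polyComp hθ)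
    ((V.numCoins_poly.polyComp PolyComp.verifierString.lengthBits).dropBits .verifierCoins)

/-- The verifier that runs the rational protocol and then compares the payment with a threshold
by `thresholdTest`, for which it uses `m n + 1` additional coins. -/
def withThreshold
    (hθ : PolyTimeComputable (fun n => [unary n, adv n]) fun n => encodeRat (θ n))
    (hm : PolyTimeUnary m) : ClassicalVerifier adv where
  numProvers := V.numProvers
  numRounds := V.numRounds
  msgLen := V.msgLen
  numCoins n := V.numCoins n + (m n + 1)
  numProvers_pos := V.numProvers_pos
  numRounds_pos := V.numRounds_pos
  msgLen_pos := V.msgLen_pos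
  numProvers_poly := V.numProvers_poly
  numRounds_poly := V.numRounds_poly
  msgLen_poly := V.msgLen_poly
  numCoins_poly := by
    have h : PolyFun fun n => V.numCoins n + (m n + 1) :=
      V.numCoins_poly.polyFun.add (hm.polyFun.add (.const 1))
    exact h.polyTimeUnary
  next x r h := V.next x (r.take (V.numCoins x.length)) h
  next_poly := by
    have hr : PolyComp (verifierInput adv) fun a => a.2.1.take (V.numCoins a.1.length) :=
      (V.numCoins_poly.polyComp PolyComp.verifierString.lengthBits).takeBits .verifierCoins
    have h := PolyComp.verifierCall V.next_poly .verifierString hr .verifierMessages (.noAdvice _)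
    exact h.polyTimeComputable
  accepts x r h :=
    thresholdTest (V.payment x (r.take (V.numCoins x.length)) h) (θ x.length)
      (r.drop (V.numCoins x.length))
  accepts_poly := (V.thresholdTest_polyComp hθ).polyTimeComputable

variable (hθ : PolyTimeComputable (fun n => [unary n, adv n]) fun n => encodeRat (θ n))
  (hm : PolyTimeUnary m) (x : List Bool) (s : Profile)

theorem play_withThreshold {r : List Bool} (hr : r.length = V.numCoins x.length) (c : List Bool)
    (j : ℕ) : (V.withThreshold hθ hm).play x (r ++ c) s j = V.play x r s j := by
  induction j with
  | zero => rfl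
  | succ j ih =>
    simp only [Protocol.play, ih]
    simp only [withThreshold, ← hr, List.take_left]

theorem acceptProb_withThreshold :
    (V.withThreshold hθ hm).acceptProb x s = coinAvg (V.numCoins x.length) fun r =>
      coinAvg (m x.length + 1) fun c =>
        if thresholdTest (V.payment x r (V.transcript x r s)) (θ x.length) c = true
        then 1 else 0 := by
  have e : (V.withThreshold hθ hm).acceptProb x s =
      coinAvg (V.numCoins x.length + (m x.length + 1)) fun r =>
        if (V.withThreshold hθ hm).accepts x r ((V.withThreshold hθ hm).transcript x r s) = true
        then 1 else 0 := rfl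
  rw [e, coinAvg_append]
  refine coinAvg_congr fun r hr => coinAvg_congr fun c _ => ?_
  have h : (V.withThreshold hθ hm).transcript x (r ++ c) s = V.transcript x r s := by
    unfold Protocol.transcript
    rw [play_withThreshold V hθ hm x s hr]
    rfl
  rw [h]
  simp only [withThreshold, ← hr, List.take_left, List.drop_left]

theorem natAbs_num_div_den {q : ℚ} (hq : 0 ≤ q) : (q.num.natAbs : ℝ) / q.den = q := by
  have h : ((q.num.natAbs : ℤ) : ℝ) = q.num := by
    rw [Int.natAbs_of_nonneg (Rat.num_nonneg.2 hq)]
  rw [← Int.cast_natCast, h]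
  exact_mod_cast Rat.num_div_den q

theorem natAbs_num_le_den {q : ℚ} (hq : 0 ≤ q) : q.num.natAbs ≤ q.den ↔ q ≤ 1 := by
  have h := natAbs_num_div_den hq
  have h1 : (0 : ℝ) < q.den := by exact_mod_cast q.den_pos
  rw [← Nat.cast_le (α := ℝ), ← div_le_one h1, h]
  norm_cast

theorem acceptProb_withThreshold_of_neg (h : θ x.length < 0) :
    (V.withThreshold hθ hm).acceptProb x s = 1 := by
  rw [acceptProb_withThreshold]
  simp [thresholdTest, h, coinAvg_const]

theorem acceptProb_withThreshold_of_one_lt (h : 1 < θ x.length) :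
    (V.withThreshold hθ hm).acceptProb x s = 0 := by
  have h0 : 0 ≤ θ x.length := zero_le_one.trans h.le
  have h1 : (θ x.length).den < (θ x.length).num.natAbs := by
    rw [← not_le, natAbs_num_le_den h0, not_le]
    exact h
  rw [acceptProb_withThreshold]
  simp [thresholdTest, h1, not_lt.2 h0, coinAvg_const]

theorem acceptProb_withThreshold_eq (h0 : 0 ≤ θ x.length) (h1 : θ x.length ≤ 1) :
    (V.withThreshold hθ hm).acceptProb x s =
      ((coinAvg (V.numCoins x.length) fun r =>
        bernoulliProb (m x.length) (V.payment x r (V.transcript x r s)).num.natAbs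
          (V.payment x r (V.transcript x r s)).den) +
        (1 - bernoulliProb (m x.length) (θ x.length).num.natAbs (θ x.length).den)) / 2 := by
  rw [acceptProb_withThreshold]
  set n := x.length with hn
  have h2 := (natAbs_num_le_den h0).2 h1
  set τ := bernoulliProb (m n) (θ n).num.natAbs (θ n).den with hτ
  have h4 : (1 : ℝ) - τ =
      coinAvg (m n) fun c => if (!bernoulli (θ n).num.natAbs (θ n).den c) = true then 1 else 0 := by
    rw [hτ, bernoulliProb, ← coinAvg_const (m n) 1, ← coinAvg_sub, coinAvg_const]
    refine coinAvg_congr fun c _ => ?_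
    cases bernoulli (θ n).num.natAbs (θ n).den c <;> simp
  rw [div_eq_inv_mul, ← coinAvg_const (V.numCoins n) (1 - τ), ← coinAvg_add, ← coinAvg_const_mul]
  refine coinAvg_congr fun r _ => ?_
  rw [h4, coinAvg_succ, div_eq_inv_mul]
  simp [thresholdTest, not_lt.2 h0, not_lt.2 h2, bernoulliProb]

theorem acceptProb_withThreshold_bounds (h0 : 0 ≤ θ x.length) (h1 : θ x.length ≤ 1) {τ : ℝ}
    (hτ : bernoulliProb (m x.length) (θ x.length).num.natAbs (θ x.length).den = τ) :
    (V.expectedPayment x s - 1 / 2 ^ m x.length + (1 - τ)) / 2 ≤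
        (V.withThreshold hθ hm).acceptProb x s ∧
      (1 - τ) / 2 ≤ (V.withThreshold hθ hm).acceptProb x s ∧
      (V.withThreshold hθ hm).acceptProb x s ≤ (V.expectedPayment x s + (1 - τ)) / 2 := by
  rw [acceptProb_withThreshold_eq V hθ hm x s h0 h1, hτ]
  set n := x.length with hn
  let R := fun r => V.payment x r (V.transcript x r s)
  have h4 : ∀ r, (R r : ℝ) - 1 / 2 ^ m n ≤ bernoulliProb (m n) (R r).num.natAbs (R r).den ∧
      bernoulliProb (m n) (R r).num.natAbs (R r).den ≤ R r := by
    intro r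
    have h5 : 0 ≤ R r := V.payment_nonneg _ _ _
    have h6 := bernoulliProb_bounds (m n) (R r).den_pos
      ((natAbs_num_le_den h5).2 (V.payment_le_one _ _ _))
    rwa [natAbs_num_div_den h5] at h6
  have h5 : V.expectedPayment x s = coinAvg (V.numCoins n) fun r => (R r : ℝ) := rfl
  have h6 := coinAvg_mono (m := V.numCoins n) fun r _ => (h4 r).1
  have h7 := coinAvg_mono (m := V.numCoins n) fun r _ => (h4 r).2
  rw [coinAvg_sub, coinAvg_const, ← h5] at h6
  rw [← h5] at h7
  have h8 : 0 ≤ coinAvg (V.numCoins n) fun r =>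
      bernoulliProb (m n) (R r).num.natAbs (R r).den :=
    coinAvg_nonneg fun r => coinAvg_nonneg fun c => by split_ifs <;> norm_num
  refine ⟨?_, ?_, ?_⟩ <;> linarith

end RationalVerifier

end InteractiveProof

/-! ### Sequential repetition -/

namespace InteractiveProof

open Machine Coded

/-- The `i`-th block of length `n` of a list. -/
def block {β : Type} (n i : ℕ) (l : List β) : List β := (l.drop (i * n)).take n

theorem block_append_of_lt {β : Type} {n i j : ℕ} {l : List β} (h : l.length = j * n) (hi : i < j)
    (l' : List β) : block n i (l ++ l') = block n i l := by
  have h1 : i * n + n ≤ l.length := by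
    rw [h, ← Nat.succ_mul]
    exact Nat.mul_le_mul_right _ hi
  unfold block
  rw [List.drop_append_of_le_length (by omega),
    List.take_append_of_le_length (by rw [List.length_drop]; omega)]

theorem block_append_self {β : Type} {n j : ℕ} {l : List β} (h : l.length = j * n) {l' : List β}
    (hl' : l'.length = n) : block n j (l ++ l') = l' := by
  unfold block
  rw [← h, List.drop_left, ← hl', List.take_length]

/-- What remains of a strategy profile when prover `i` has already seen `seen i`. -/
def Profile.after (s : Profile) (seen : ℕ → List (List Bool × List Bool)) : Profile :=
  fun i tr => s i (seen i ++ tr)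

/-- The strategy profile that plays the given profile, with `k` rounds, over and over again, without
regard to the earlier repetitions. -/
def Profile.cyclic (k : ℕ) (s : Profile) : Profile :=
  fun i tr => s i (tr.drop (tr.length / k * k))

theorem Profile.cyclic_append {k j : ℕ} (s : Profile) (i : ℕ)
    {w tr : List (List Bool × List Bool)} (hw : w.length = j * k) (htr : tr.length < k) :
    s.cyclic k i (w ++ tr) = s i tr := by
  have h : (w ++ tr).length / k = j := by
    rw [List.length_append, hw]
    refine Nat.div_eq_of_lt_le (by omega) ?_
    rw [Nat.succ_mul]
    omega
  rw [Profile.cyclic, h, ← hw, List.drop_left]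

namespace Protocol

variable {adv : ℕ → List Letter} (V : Protocol adv) (x : List Bool) (s : Profile)

/-- The result of playing the protocol repeatedly, where the provers remember everything and the
`i`-th repetition uses the coins `R i`: all messages to the verifier, and what each prover has
seen. -/
def playBlocks {adv : ℕ → List Letter} (V : Protocol adv) (x : List Bool) (s : Profile)
    (R : ℕ → List Bool) : ℕ → List (List Bool) × (ℕ → List (List Bool × List Bool))
  | 0 => ([], fun _ => [])
  | i + 1 =>
    let st := V.playBlocks x s R i
    let st' := V.play x (R i) (s.after st.2) (V.numRounds x.length)
    (st.1 ++ st'.1, fun p => st.2 p ++ st'.2 p)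

theorem playBlocks_congr {R R' : ℕ → List Bool} {i : ℕ} (h : ∀ j < i, R j = R' j) :
    V.playBlocks x s R i = V.playBlocks x s R' i := by
  induction i with
  | zero => rfl
  | succ i ih =>
    simp only [playBlocks, ih fun j hj => h j (by omega), h i (by omega)]

theorem length_playBlocks_fst (R : ℕ → List Bool) (i : ℕ) :
    (V.playBlocks x s R i).1.length = i * (V.numRounds x.length * V.numProvers x.length) := by
  induction i with
  | zero => simp [playBlocks]
  | succ i ih => simp [playBlocks, ih, length_play_fst, Nat.succ_mul]

theorem length_playBlocks_snd (R : ℕ → List Bool) (i p : ℕ) :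
    ((V.playBlocks x s R i).2 p).length = i * V.numRounds x.length := by
  induction i with
  | zero => simp [playBlocks]
  | succ i ih => simp [playBlocks, ih, length_play_snd, Nat.succ_mul]

theorem block_playBlocks (R : ℕ → List Bool) {i n : ℕ} (hi : i < n) :
    block (V.numRounds x.length * V.numProvers x.length) i (V.playBlocks x s R n).1 =
      V.transcript x (R i) (s.after (V.playBlocks x s R i).2) := by
  induction n with
  | zero => omega
  | succ n ih =>
    have h1 := V.length_playBlocks_fst x s R n
    rcases Nat.lt_succ_iff_lt_or_eq.1 hi with h | rfl
    · rw [← ih h]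
      exact block_append_of_lt h1 h _
    · exact block_append_self h1 (V.length_play_fst x _ _ _)

end Protocol

namespace ClassicalVerifier

variable {adv : ℕ → List Letter} (M : ClassicalVerifier adv)

theorem acceptProb_eq (x : List Bool) (s : Profile) :
    M.acceptProb x s = coinAvg (M.numCoins x.length) fun r =>
      if M.accepts x r (M.transcript x r s) = true then 1 else 0 := rfl

/-- The number of messages that the verifier receives. -/
def numMessages (n : ℕ) : ℕ := M.numRounds n * M.numProvers n

theorem numMessages_pos (n : ℕ) : 0 < M.numMessages n :=
  Nat.mul_pos (M.numRounds_pos n) (M.numProvers_pos n)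

theorem numMessages_polyComp : PolyComp (verifierInput adv) fun a => M.numMessages a.1.length :=
  (M.numRounds_poly.polyComp PolyComp.verifierString.lengthBits).mul
    (M.numProvers_poly.polyComp PolyComp.verifierString.lengthBits)

theorem numCoins_polyComp : PolyComp (verifierInput adv) fun a => M.numCoins a.1.length :=
  M.numCoins_poly.polyComp PolyComp.verifierString.lengthBits

/-- The number of accepting runs among the first `n`, when the coins and the messages of the runs
are listed one after the other. -/
def acceptCount (n : ℕ) (x r : List Bool) (h : List (List Bool)) : ℕ :=
  ∑ i ∈ Finset.range n, if M.accepts x (block (M.numCoins x.length) i r)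
    (block (M.numMessages x.length) i h) = true then 1 else 0

theorem length_words_drop_le (n : ℕ) (h : List (List Bool)) :
    (words (h.drop n)).length ≤ (words h).length := by
  conv_rhs => rw [← List.take_append_drop n h, words_append, List.length_append]
  omega

theorem acceptCount_polyComp {N : ℕ → ℕ} (hN : PolyTimeUnary N) :
    PolyComp (verifierInput adv) fun a => M.acceptCount (N a.1.length) a.1 a.2.1 a.2.2 := by
  let step : List Bool × List Bool × List (List Bool) → List Bool × List (List Bool) × ℕ →
      List Bool × List (List Bool) × ℕ := fun a s =>
    (s.1.drop (M.numCoins a.1.length), s.2.1.drop (M.numMessages a.1.length),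
      s.2.2 + if M.accepts a.1 (s.1.take (M.numCoins a.1.length))
        (s.2.1.take (M.numMessages a.1.length)) then 1 else 0)
  have h1 : PolyComp (foldContext (verifierInput adv)
      (enc : List Bool × List (List Bool) × ℕ → _)) fun q => q.2.2.1 := PolyComp.state.fst
  have h2 : PolyComp (foldContext (verifierInput adv)
      (enc : List Bool × List (List Bool) × ℕ → _)) fun q => q.2.2.2.1 := PolyComp.state.snd.fst
  have h3 : PolyComp (foldContext (verifierInput adv)
      (enc : List Bool × List (List Bool) × ℕ → _)) fun q => q.2.2.2.2 := PolyComp.state.snd.snd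
  have hacc := PolyComp.verifierCall M.accepts_poly
    (PolyComp.verifierString.input (S := List Bool × List (List Bool) × ℕ))
    (M.numCoins_polyComp.input.takeBits h1) (M.numMessages_polyComp.input.takeMessages h2)
    PolyComp.verifierAdvice.input
  have hacc' : PolyComp (foldContext (verifierInput adv)
      (enc : List Bool × List (List Bool) × ℕ → _)) fun q =>
      M.accepts q.1.1 (q.2.2.1.take (M.numCoins q.1.1.length))
        (q.2.2.2.1.take (M.numMessages q.1.1.length)) := hacc
  have hstep : PolyComp (foldContext (verifierInput adv)
      (enc : List Bool × List (List Bool) × ℕ → _)) fun q => step q.1 q.2.2 :=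
    (M.numCoins_polyComp.input.dropBits h1).pair
      ((M.numMessages_polyComp.input.dropMessages h2).pair
        (h3.add (hacc'.ite (.const 1) (.const 0))))
  have h4 := PolyComp.iterate (step := step) (hN.polyComp PolyComp.verifierString.lengthBits)
    (PolyComp.verifierCoins.pair (PolyComp.verifierMessages.pair (.const 0))) hstep 1 fun a s => by
      have h5 := length_words_drop_le (M.numMessages a.1.length) s.2.1
      simp only [step, total_enc_prod, total_enc_bits, total_enc_messages, total_enc_nat,
        List.length_drop, Polynomial.eval_one]
      split_ifs <;> omega
  refine h4.snd.snd.congr fun a => ?_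
  have key : ∀ n, (step a)^[n] (a.2.1, a.2.2, 0) = (a.2.1.drop (n * M.numCoins a.1.length),
      a.2.2.drop (n * M.numMessages a.1.length), M.acceptCount n a.1 a.2.1 a.2.2) := by
    intro n
    induction n with
    | zero => simp [acceptCount]
    | succ n ih =>
      rw [Function.iterate_succ_apply', ih]
      simp only [step, List.drop_drop, ← Nat.succ_mul, Nat.succ_eq_add_one, acceptCount, Finset.sum_range_succ, block]
      rfl
  rw [key]

/-- The index of the repetition in which the last of the messages `h` was sent. -/
def currentRun (n : ℕ) (h : List (List Bool)) : ℕ := (h.length - 1) / M.numMessages n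

theorem currentRun_eq {n i : ℕ} {h h' : List (List Bool)} (h1 : h.length = i * M.numMessages n)
    (h2 : 0 < h'.length) (h3 : h'.length ≤ M.numMessages n) : M.currentRun n (h ++ h') = i := by
  unfold currentRun
  rw [List.length_append, h1]
  refine Nat.div_eq_of_lt_le (by omega) ?_
  rw [Nat.succ_mul]
  omega

theorem currentRun_polyComp :
    PolyComp (verifierInput adv) fun a => M.currentRun a.1.length a.2.2 :=
  (PolyComp.verifierMessages.lengthMessages.sub (.const 1)).div M.numMessages_polyComp
    fun _ => M.numMessages_pos _

variable {N : ℕ → ℕ}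

/-- The verifier that runs `M` one after the other `N n` times, with fresh coins, and accepts if
`M` accepts in more than half of the runs. -/
def majority (hN : PolyTimeUnary N) (hpos : ∀ n, 0 < N n) : ClassicalVerifier adv where
  numProvers := M.numProvers
  numRounds n := N n * M.numRounds n
  msgLen := M.msgLen
  numCoins n := N n * M.numCoins n
  numProvers_pos := M.numProvers_pos
  numRounds_pos n := Nat.mul_pos (hpos n) (M.numRounds_pos n)
  msgLen_pos := M.msgLen_pos
  numProvers_poly := M.numProvers_poly
  numRounds_poly := by
    have h : PolyFun fun n => N n * M.numRounds n := hN.polyFun.mul M.numRounds_poly.polyFun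
    exact h.polyTimeUnary
  msgLen_poly := M.msgLen_poly
  numCoins_poly := by
    have h : PolyFun fun n => N n * M.numCoins n := hN.polyFun.mul M.numCoins_poly.polyFun
    exact h.polyTimeUnary
  next x r h := M.next x (block (M.numCoins x.length) (M.currentRun x.length h) r)
    (h.drop (M.currentRun x.length h * M.numMessages x.length))
  next_poly := by
    have h := PolyComp.verifierCall M.next_poly .verifierString
      (M.numCoins_polyComp.takeBits
        ((M.currentRun_polyComp.mul M.numCoins_polyComp).dropBits .verifierCoins))
      ((M.currentRun_polyComp.mul M.numMessages_polyComp).dropMessages .verifierMessages)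
      .verifierAdvice
    exact h.polyTimeComputable
  accepts x r h := decide (N x.length < 2 * M.acceptCount (N x.length) x r h)
  accepts_poly := by
    have h : PolyComp (verifierInput adv) fun a =>
        decide (N a.1.length < 2 * M.acceptCount (N a.1.length) a.1 a.2.1 a.2.2) :=
      (hN.polyComp PolyComp.verifierString.lengthBits).lt
        ((PolyComp.const 2).mul (M.acceptCount_polyComp hN))
    exact h.polyTimeComputable

variable (hN : PolyTimeUnary N) (hpos : ∀ n, 0 < N n) (x r : List Bool) (s : Profile)

/-- The coins of the single runs. -/
def coinBlocks (r : List Bool) (i : ℕ) : List Bool := block (M.numCoins x.length) i r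

theorem play_majority (i j : ℕ) (hj : j ≤ M.numRounds x.length) :
    (M.majority hN hpos).play x r s (i * M.numRounds x.length + j) =
      ((M.playBlocks x s (M.coinBlocks x r) i).1 ++
        (M.play x (M.coinBlocks x r i)
          (s.after (M.playBlocks x s (M.coinBlocks x r) i).2) j).1,
      fun p => (M.playBlocks x s (M.coinBlocks x r) i).2 p ++
        (M.play x (M.coinBlocks x r i)
          (s.after (M.playBlocks x s (M.coinBlocks x r) i).2) j).2 p) := by
  have hstep : ∀ i j, j < M.numRounds x.length →
      (M.majority hN hpos).play x r s (i * M.numRounds x.length + j) =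
        ((M.playBlocks x s (M.coinBlocks x r) i).1 ++
          (M.play x (M.coinBlocks x r i)
            (s.after (M.playBlocks x s (M.coinBlocks x r) i).2) j).1,
        fun p => (M.playBlocks x s (M.coinBlocks x r) i).2 p ++
          (M.play x (M.coinBlocks x r i)
            (s.after (M.playBlocks x s (M.coinBlocks x r) i).2) j).2 p) →
      (M.majority hN hpos).play x r s (i * M.numRounds x.length + (j + 1)) =
        ((M.playBlocks x s (M.coinBlocks x r) i).1 ++
          (M.play x (M.coinBlocks x r i)
            (s.after (M.playBlocks x s (M.coinBlocks x r) i).2) (j + 1)).1,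
        fun p => (M.playBlocks x s (M.coinBlocks x r) i).2 p ++
          (M.play x (M.coinBlocks x r i)
            (s.after (M.playBlocks x s (M.coinBlocks x r) i).2) (j + 1)).2 p) := by
    intro i j hj ih
    have hlen := M.length_playBlocks_fst x s (M.coinBlocks x r) i
    have hlen' := M.length_play_fst x (M.coinBlocks x r i)
      (s.after (M.playBlocks x s (M.coinBlocks x r) i).2) (j + 1)
    have h1 : 0 < (j + 1) * M.numProvers x.length :=
      Nat.mul_pos (Nat.succ_pos _) (M.numProvers_pos _)
    have h2 : (j + 1) * M.numProvers x.length ≤ M.numMessages x.length :=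
      Nat.mul_le_mul_right _ hj
    rw [← hlen'] at h1 h2
    have hrun := M.currentRun_eq hlen h1 h2
    have hdrop : ∀ g, ((M.playBlocks x s (M.coinBlocks x r) i).1 ++ g).drop
        (i * M.numMessages x.length) = g := fun g => by
      rw [numMessages, ← hlen, List.drop_left]
    rw [← add_assoc, Protocol.play, ih]
    simp only [Protocol.play, Profile.after] at hrun hdrop ⊢
    simp only [majority, List.append_assoc] at hrun ⊢
    simp only [hrun, hdrop]
    rfl
  induction i generalizing j with
  | zero =>
    induction j with
    | zero => simp [Protocol.play, Protocol.playBlocks]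
    | succ j ih => exact hstep _ _ hj (ih (by omega))
  | succ i ih0 =>
    induction j with
    | zero =>
      have := ih0 _ le_rfl
      rw [← Nat.succ_mul] at this
      simpa [Protocol.play, Protocol.playBlocks] using this
    | succ j ih => exact hstep _ _ hj (ih (by omega))

/-- Whether the `i`-th run is accepted. -/
def runAccepted (i : ℕ) : Bool :=
  M.accepts x (M.coinBlocks x r i) (M.transcript x (M.coinBlocks x r i)
    (s.after (M.playBlocks x s (M.coinBlocks x r) i).2))

theorem acceptCount_transcript_majority :
    M.acceptCount (N x.length) x r ((M.majority hN hpos).transcript x r s) =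
      ∑ i ∈ Finset.range (N x.length), if M.runAccepted x r s i = true then 1 else 0 := by
  have h := M.play_majority hN hpos x r s (N x.length) 0 (Nat.zero_le _)
  have h' : (M.majority hN hpos).transcript x r s =
      (M.playBlocks x s (M.coinBlocks x r) (N x.length)).1 := by
    have e := congrArg Prod.fst h
    simp only [Protocol.play, add_zero, List.append_nil] at e
    exact e
  rw [h']
  refine Finset.sum_congr rfl fun i hi => ?_
  rw [numMessages, M.block_playBlocks x s _ (Finset.mem_range.1 hi)]
  rfl

theorem acceptProb_majority :
    (M.majority hN hpos).acceptProb x s =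
      coinAvg (N x.length * M.numCoins x.length) fun r =>
        if N x.length < 2 * ∑ i ∈ Finset.range (N x.length),
          (if M.runAccepted x r s i = true then 1 else 0) then 1 else 0 := by
  rw [acceptProb_eq]
  refine coinAvg_congr fun r _ => ?_
  have h : (M.majority hN hpos).accepts x r ((M.majority hN hpos).transcript x r s) =
      decide (N x.length < 2 * M.acceptCount (N x.length) x r
        ((M.majority hN hpos).transcript x r s)) := rfl
  rw [h, acceptCount_transcript_majority]
  simp only [decide_eq_true_eq]

variable {r}

theorem coinBlocks_append_of_lt {i j : ℕ} (hr : r.length = j * M.numCoins x.length) (hi : i < j)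
    (r' : List Bool) : M.coinBlocks x (r ++ r') i = M.coinBlocks x r i :=
  block_append_of_lt hr hi r'

theorem runAccepted_append_of_lt {i j : ℕ} (hr : r.length = j * M.numCoins x.length) (hi : i < j)
    (r' : List Bool) : M.runAccepted x (r ++ r') s i = M.runAccepted x r s i := by
  unfold runAccepted
  rw [M.coinBlocks_append_of_lt x hr hi, M.playBlocks_congr x s fun k hk =>
    M.coinBlocks_append_of_lt x hr (hk.trans hi) r']

/-- Given the coins of the earlier runs, the next run is accepted with the probability with which
`M` accepts the strategy profile that the provers then follow. -/
theorem coinAvg_runAccepted {j : ℕ} (hr : r.length = j * M.numCoins x.length) :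
    (coinAvg (M.numCoins x.length) fun r' =>
      if M.runAccepted x (r ++ r') s j = true then 1 else 0) =
      M.acceptProb x (s.after (M.playBlocks x s (M.coinBlocks x r) j).2) := by
  rw [acceptProb_eq]
  refine coinAvg_congr fun r' hr' => ?_
  unfold runAccepted
  rw [M.playBlocks_congr x s fun k hk => M.coinBlocks_append_of_lt x hr hk r']
  have : M.coinBlocks x (r ++ r') j = r' := block_append_self hr hr'
  rw [this]

/-- If the provers play cyclically, then they follow the given profile in every run. -/
theorem acceptProb_cyclic (R : ℕ → List Bool) (j : ℕ) :
    M.acceptProb x (Profile.after (s.cyclic (M.numRounds x.length))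
      (M.playBlocks x (s.cyclic (M.numRounds x.length)) R j).2) = M.acceptProb x s := by
  rw [acceptProb_eq, acceptProb_eq]
  refine coinAvg_congr fun r _ => ?_
  have h := M.play_congr x r (s := Profile.after (s.cyclic (M.numRounds x.length))
    (M.playBlocks x (s.cyclic (M.numRounds x.length)) R j).2) (s' := s)
    (k := M.numRounds x.length) (fun i tr htr => ?_) le_rfl
  · unfold Protocol.transcript
    rw [h]
  · exact Profile.cyclic_append s i (M.length_playBlocks_snd x _ R j i) htr

/-- Soundness of the repetition, for a given profile. -/
theorem acceptProb_majority_le {d : ℝ} (hd : 0 < d) (hd' : d ≤ 1 / 2)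
    (h : ∀ s, M.acceptProb x s ≤ 1 / 2 - d) :
    (M.majority hN hpos).acceptProb x s ≤ 1 / (N x.length * d ^ 2) := by
  rw [acceptProb_majority]
  refine coinAvg_deviation_le _
    (fun i r => (if M.runAccepted x r s i = true then 1 else 0) - (1 / 2 - d))
    (fun i j r r' hr hij => by simp only [M.runAccepted_append_of_lt x s hr hij])
    (fun j r => by rw [abs_le]; split_ifs <;> constructor <;> linarith)
    (fun j r hr => by
      rw [coinAvg_sub, coinAvg_const, M.coinAvg_runAccepted x s hr]
      linarith [h (s.after (M.playBlocks x s (M.coinBlocks x r) j).2)])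
    (hpos _) hd (fun r => by split_ifs <;> norm_num) fun r _ hf => ?_
  have h1 : N x.length < 2 * ∑ i ∈ Finset.range (N x.length),
      (if M.runAccepted x r s i = true then 1 else 0) := by
    by_contra h2
    rw [if_neg h2] at hf
    exact lt_irrefl _ hf
  have h2 : (N x.length : ℝ) < 2 * ∑ i ∈ Finset.range (N x.length),
      (if M.runAccepted x r s i = true then 1 else 0) := by exact_mod_cast h1
  simp only [Finset.sum_sub_distrib, Finset.sum_const, Finset.card_range, nsmul_eq_mul]
  linarith

/-- Completeness of the repetition. -/
theorem le_acceptProb_majority_cyclic {d : ℝ} (hd : 0 < d) (hd' : d ≤ 1 / 2)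
    (h : 1 / 2 + d ≤ M.acceptProb x s) :
    1 - 1 / (N x.length * d ^ 2) ≤
      (M.majority hN hpos).acceptProb x (s.cyclic (M.numRounds x.length)) := by
  rw [acceptProb_majority]
  set s' := s.cyclic (M.numRounds x.length) with hs'
  have key := coinAvg_deviation_le (M.numCoins x.length)
    (fun i r => (1 / 2 + d) - (if M.runAccepted x r s' i = true then 1 else 0))
    (fun i j r r' hr hij => by simp only [M.runAccepted_append_of_lt x s' hr hij])
    (fun j r => by rw [abs_le]; split_ifs <;> constructor <;> linarith)
    (fun j r hr => by
      rw [coinAvg_sub, coinAvg_const, M.coinAvg_runAccepted x s' hr, M.acceptProb_cyclic x s]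
      linarith)
    (hpos x.length) hd
    (f := fun r => 1 - if N x.length < 2 * ∑ i ∈ Finset.range (N x.length),
          (if M.runAccepted x r s' i = true then 1 else 0) then 1 else 0)
    (fun r => by split_ifs <;> norm_num) fun r _ hf => by
      have h1 : ¬ N x.length < 2 * ∑ i ∈ Finset.range (N x.length),
          (if M.runAccepted x r s' i = true then 1 else 0) := by
        intro h2
        rw [if_pos h2] at hf
        norm_num at hf
      have h2 : 2 * (∑ i ∈ Finset.range (N x.length),
          (if M.runAccepted x r s' i = true then 1 else 0) : ℝ) ≤ N x.length := by
        exact_mod_cast not_lt.1 h1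
      simp only [Finset.sum_sub_distrib, Finset.sum_const, Finset.card_range, nsmul_eq_mul]
      linarith
  rw [coinAvg_sub, coinAvg_const] at key
  linarith

/-- Error reduction: a protocol that is correct with an inverse polynomial advantage over `1 / 2`
can be repeated so as to make the error inverse polynomially small. -/
theorem exists_amplified {L : Set (List Bool)} (g : Polynomial ℕ) (hg : ∀ n, 2 ≤ g.eval n)
    (h : M.IsMIP L (fun n => 1 / 2 + 1 / ((g.eval n : ℕ) : ℝ))
      fun n => 1 / 2 - 1 / ((g.eval n : ℕ) : ℝ)) (q : Polynomial ℕ) :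
    ∃ M' : ClassicalVerifier adv, M'.numProvers = M.numProvers ∧
      M'.IsMIP L (fun n => 1 - 1 / (((q.eval n : ℕ) : ℝ) + 1))
        (fun n => 1 / (((q.eval n : ℕ) : ℝ) + 1)) := by
  -- With `N = (q + 1) g²` runs and advantage `d = 1 / g`, the error `1 / (N d²)` is `1 / (q + 1)`.
  let b : Polynomial ℕ := (q + 1) * g ^ 2
  have hb : ∀ n, b.eval n = (q.eval n + 1) * g.eval n ^ 2 := fun n => by simp [b]
  have hN : PolyTimeUnary fun n => b.eval n := (PolyComp.id.polynomial b).polyTimeUnary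
  have hpos : ∀ n, 0 < b.eval n := fun n => by
    rw [hb]
    have := hg n
    positivity
  have hg' : ∀ n, (2 : ℝ) ≤ (g.eval n : ℕ) := fun n => by exact_mod_cast hg n
  have he : ∀ n, (1 : ℝ) / ((b.eval n : ℕ) * (1 / ((g.eval n : ℕ) : ℝ)) ^ 2) =
      1 / (((q.eval n : ℕ) : ℝ) + 1) := fun n => by
    have := hg' n
    rw [hb]
    push_cast
    field_simp
  have hd : ∀ n, (0 : ℝ) < 1 / ((g.eval n : ℕ) : ℝ) := fun n => by
    have := hg' n
    positivity
  have hd' : ∀ n, (1 : ℝ) / ((g.eval n : ℕ) : ℝ) ≤ 1 / 2 := fun n =>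
    one_div_le_one_div_of_le two_pos (hg' n)
  refine ⟨M.majority hN hpos, rfl, fun x hx => ?_, fun x hx s => ?_⟩
  · obtain ⟨s, hs⟩ := h.1 x hx
    refine ⟨_, (M.le_acceptProb_majority_cyclic hN hpos x s (hd _) (hd' _) hs).trans_eq' ?_⟩
    rw [he]
  · exact (M.acceptProb_majority_le hN hpos x s (hd _) (hd' _) fun s => h.2 x hx s).trans_eq (he _)

end ClassicalVerifier

end InteractiveProof

/-! ### Thresholds -/

namespace InteractiveProof

open Machine Coded

namespace RationalVerifier

variable (V : RationalVerifier)

/-- The largest expected payment on input `x`. -/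
noncomputable def value (x : List Bool) : ℝ := V.expectedPayment x (V.exists_isOptimal x).choose

variable {V}

theorem expectedPayment_le_value (x : List Bool) (s : Profile) :
    V.expectedPayment x s ≤ V.value x := (V.exists_isOptimal x).choose_spec s

theorem IsOptimal.expectedPayment_eq {x : List Bool} {s : Profile} (h : V.IsOptimal x s) :
    V.expectedPayment x s = V.value x := le_antisymm (expectedPayment_le_value x s) (h _)

theorem expectedPayment_eq (x : List Bool) (s : Profile) :
    V.expectedPayment x s = coinAvg (V.numCoins x.length) fun r =>
      (V.payment x r (V.transcript x r s) : ℝ) := rfl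

theorem value_nonneg (x : List Bool) : 0 ≤ V.value x := by
  rw [value, expectedPayment_eq]
  exact coinAvg_nonneg fun _ => by exact_mod_cast V.payment_nonneg _ _ _

theorem value_le_one (x : List Bool) : V.value x ≤ 1 := by
  rw [value, expectedPayment_eq]
  exact coinAvg_le_one fun _ => by exact_mod_cast V.payment_le_one _ _ _

/-- If on all inputs the largest payment keeps some distance from a polynomial-time computable
threshold, which it exceeds precisely for the members of `L`, then `L` has protocols with small
error. -/
theorem exists_isMIP_of_threshold {L : Set (List Bool)} {γ : ℕ → ℝ} (hγ : ∀ n, 1 < γ n)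
    {G : Polynomial ℕ} (hG : ∀ n, γ n ≤ (G.eval n : ℕ)) {adv : ℕ → List Letter} {θ : ℕ → ℚ}
    (hθ : PolyTimeComputable (fun n => [unary n, adv n]) fun n => encodeRat (θ n))
    (hmem : ∀ x ∈ L, (θ x.length : ℝ) + 1 / (4 * γ x.length) ≤ V.value x)
    (hnot : ∀ x ∉ L, V.value x ≤ (θ x.length : ℝ) - 1 / (4 * γ x.length)) (q : Polynomial ℕ) :
    ∃ M : ClassicalVerifier adv, M.numProvers = V.numProvers ∧
      M.IsMIP L (fun n => 1 - 1 / (((q.eval n : ℕ) : ℝ) + 1))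
        (fun n => 1 / (((q.eval n : ℕ) : ℝ) + 1)) := by
  -- As `2 ^ m > m`, with `8 * G n` coins the probabilities have precision `1 / (8 * γ n)`. This is
  -- half of the distance of the payments from the threshold.
  have hm : PolyTimeUnary fun n => (8 * G).eval n := (PolyComp.id.polynomial _).polyTimeUnary
  have hG1 : ∀ n, (1 : ℝ) < (G.eval n : ℕ) := fun n => (hγ n).trans_le (hG n)
  have hprec : ∀ n, (1 : ℝ) / 2 ^ (8 * G).eval n ≤ 1 / (8 * γ n) := by
    intro n
    have h1 : (((8 * G).eval n : ℕ) : ℝ) < ((2 ^ (8 * G).eval n : ℕ) : ℝ) := by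
      exact_mod_cast Nat.lt_two_pow_self
    have h2 : (((8 * G).eval n : ℕ) : ℝ) = 8 * (G.eval n : ℕ) := by simp
    have h3 := hγ n
    have h4 := hG n
    rw [h2] at h1
    push_cast at h1
    exact one_div_le_one_div_of_le (by linarith) (by linarith)
  have hadv : ∀ n, (1 : ℝ) / ((((16 * G).eval n : ℕ)) : ℝ) ≤ 1 / (16 * γ n) := by
    intro n
    have h2 : (((16 * G).eval n : ℕ) : ℝ) = 16 * (G.eval n : ℕ) := by simp
    have h3 := hγ n
    rw [h2]
    exact one_div_le_one_div_of_le (by linarith) (by linarith [hG n])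
  have hsmall : ∀ n, (1 : ℝ) / (16 * γ n) ≤ 1 / 16 := fun n =>
    one_div_le_one_div_of_le (by norm_num) (by linarith [hγ n])
  have e1 : ∀ n, (1 : ℝ) / (4 * γ n) = 4 * (1 / (16 * γ n)) := fun n => by
    have := hγ n
    field_simp
    norm_num
  have e2 : ∀ n, (1 : ℝ) / (8 * γ n) = 2 * (1 / (16 * γ n)) := fun n => by
    have := hγ n
    field_simp
    norm_num
  have hpos : ∀ n, (0 : ℝ) < 1 / (16 * γ n) := fun n => by
    have := hγ n
    positivity
  refine ClassicalVerifier.exists_amplified (V.withThreshold hθ hm) (16 * G) (fun n => ?_)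
    ⟨fun x hx => ?_, fun x hx s => ?_⟩ q
  · have h1 : 1 < G.eval n := by exact_mod_cast hG1 n
    simp
    omega
  · obtain ⟨s, hs⟩ := V.exists_isOptimal x
    refine ⟨s, ?_⟩
    have h1 := hmem x hx
    have h2 := hprec x.length
    have h3 := hadv x.length
    have h4 := hsmall x.length
    have h5 := hpos x.length
    have h6 := value_le_one (V := V) x
    rw [e1] at h1
    rw [e2] at h2
    rcases lt_or_ge (θ x.length) 0 with hneg | h0
    · rw [acceptProb_withThreshold_of_neg V hθ hm x s hneg]
      linarith
    · have hle : θ x.length ≤ 1 := by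
        have : (θ x.length : ℝ) ≤ 1 := by linarith
        exact_mod_cast this
      have h7 := (acceptProb_withThreshold_bounds V hθ hm x s h0 hle rfl).1
      have h8 := (bernoulliProb_bounds ((8 * G).eval x.length) (θ x.length).den_pos
        ((natAbs_num_le_den h0).2 hle)).2
      rw [natAbs_num_div_den h0] at h8
      rw [hs.expectedPayment_eq] at h7
      linarith
  · have h1 := hnot x hx
    have h2 := hprec x.length
    have h3 := hadv x.length
    have h4 := hsmall x.length
    have h5 := hpos x.length
    have h6 := value_nonneg (V := V) x
    have h9 := expectedPayment_le_value (V := V) x s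
    rw [e1] at h1
    rw [e2] at h2
    rcases lt_or_ge 1 (θ x.length) with hbig | hle
    · rw [acceptProb_withThreshold_of_one_lt V hθ hm x s hbig]
      linarith
    · have h0 : 0 ≤ θ x.length := by
        have : (0 : ℝ) ≤ (θ x.length : ℝ) := by linarith
        exact_mod_cast this
      have h7 := (acceptProb_withThreshold_bounds V hθ hm x s h0 hle rfl).2.2
      have h8 := (bernoulliProb_bounds ((8 * G).eval x.length) (θ x.length).den_pos
        ((natAbs_num_le_den h0).2 hle)).1
      rw [natAbs_num_div_den h0] at h8
      linarith

/-- On inputs of a fixed length, either all or none are in `L`, or the payments for members are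
separated from those for non-members by a member `x` of least value and a non-member `y` of
greatest value. -/
theorem trichotomy (V : RationalVerifier) (L : Set (List Bool)) (n : ℕ) :
    (∀ x : List Bool, x.length = n → x ∈ L) ∨ (∀ x : List Bool, x.length = n → x ∉ L) ∨
    ∃ x y : List Bool, x.length = n ∧ y.length = n ∧ x ∈ L ∧ y ∉ L ∧
      (∀ z ∈ L, z.length = n → V.value x ≤ V.value z) ∧
      ∀ z ∉ L, z.length = n → V.value z ≤ V.value y := by
  by_cases h1 : ∀ x : List Bool, x.length = n → x ∈ L
  · exact Or.inl h1
  by_cases h2 : ∀ x : List Bool, x.length = n → x ∉ L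
  · exact Or.inr (Or.inl h2)
  push Not at h1 h2
  obtain ⟨y0, hy0, hy0'⟩ := h1
  obtain ⟨x0, hx0, hx0'⟩ := h2
  have hfin : {x : List Bool | x.length = n}.Finite := List.finite_length_eq _ _
  obtain ⟨x, hx, hxmin⟩ := Set.exists_min_image {x : List Bool | x.length = n ∧ x ∈ L} V.value
    (hfin.subset fun x hx => hx.1) ⟨x0, hx0, hx0'⟩
  obtain ⟨y, hy, hymax⟩ := Set.exists_max_image {x : List Bool | x.length = n ∧ x ∉ L} V.value
    (hfin.subset fun x hx => hx.1) ⟨y0, hy0, hy0'⟩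
  exact Or.inr (Or.inr ⟨x, y, hx.1, hy.1, hx.2, hy.2, fun z hz hn => hxmin z ⟨hn, hz⟩,
    fun z hz hn => hymax z ⟨hn, hz⟩⟩)

end RationalVerifier

/-- A function that is bounded by a power for large arguments is bounded by a polynomial. -/
theorem exists_polynomial_bound {γ : ℕ → ℝ} {k : ℕ}
    (h : γ =O[Filter.atTop] fun n : ℕ => (n : ℝ) ^ k) :
    ∃ A : ℕ, ∀ n, γ n ≤ (A * (n + 1) ^ k : ℕ) := by
  obtain ⟨c, hc⟩ := h.bound
  obtain ⟨N, hN⟩ := Filter.eventually_atTop.1 hc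
  refine ⟨⌈c⌉₊ + ∑ i ∈ Finset.range N, ⌈γ i⌉₊, fun n => ?_⟩
  push_cast
  have h1 : (1 : ℝ) ≤ ((n : ℝ) + 1) ^ k := one_le_pow₀ (by linarith [n.cast_nonneg (α := ℝ)])
  have h2 : (0 : ℝ) ≤ ∑ i ∈ Finset.range N, (⌈γ i⌉₊ : ℝ) :=
    Finset.sum_nonneg fun _ _ => Nat.cast_nonneg _
  rcases lt_or_ge n N with hn | hn
  · have h3 := Finset.single_le_sum (f := fun i => (⌈γ i⌉₊ : ℝ)) (fun _ _ => Nat.cast_nonneg _)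
      (Finset.mem_range.2 hn)
    have h4 := Nat.le_ceil (γ n)
    have h5 : (0 : ℝ) ≤ ⌈c⌉₊ := Nat.cast_nonneg _
    nlinarith
  · have h3 := (le_abs_self _).trans (hN n hn)
    rw [norm_pow, Real.norm_natCast] at h3
    have h4 : (n : ℝ) ^ k ≤ ((n : ℝ) + 1) ^ k := by gcongr; linarith
    have h5 := Nat.le_ceil c
    have h6 : (0 : ℝ) ≤ (n : ℝ) ^ k := by positivity
    have h7 : (0 : ℝ) ≤ ⌈c⌉₊ := Nat.cast_nonneg _
    nlinarith [mul_le_mul_of_nonneg_right h5 h6, mul_le_mul_of_nonneg_left h4 h7]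

theorem length_encodeRat_le {q : ℚ} {D : ℕ} (h1 : q.num.natAbs ≤ D) (h2 : q.den ≤ D) :
    (encodeRat q).length ≤ 4 + 2 * D.size := by
  have h3 := Nat.size_le_size h1
  have h4 := Nat.size_le_size h2
  simp only [encodeRat, words_cons, words_nil, List.length_append, List.length_cons, length_word,
    Nat.size_eq_bits_len, List.length_nil]
  omega

theorem size_mul_pow_le (A k n : ℕ) :
    (A * (n + 1) ^ k).size ≤ (A.size + k) * (Nat.log 2 n + 1) := by
  rw [Nat.size_le]
  have h1 : n + 1 ≤ 2 ^ (Nat.log 2 n + 1) := Nat.lt_pow_succ_log_self one_lt_two n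
  have h2 : A < 2 ^ A.size := Nat.lt_size_self A
  have h3 : (n + 1) ^ k ≤ 2 ^ (k * (Nat.log 2 n + 1)) := by
    rw [mul_comm, pow_mul]
    exact Nat.pow_le_pow_left h1 k
  calc A * (n + 1) ^ k < 2 ^ A.size * 2 ^ (k * (Nat.log 2 n + 1)) :=
        Nat.mul_lt_mul_of_lt_of_le h2 h3 (by positivity)
    _ = 2 ^ (A.size + k * (Nat.log 2 n + 1)) := (pow_add _ _ _).symm
    _ ≤ _ := Nat.pow_le_pow_right two_pos (by nlinarith)

/-- Between two numbers in `[0, 1]` whose distance is more than `1 / g` there is a fraction with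
denominator at most `D`, at distance at least `1 / (4 * g)` from both, provided that
`4 * g ≤ D`. -/
theorem exists_rat_between {a b g : ℝ} {D : ℕ} (hg : 0 < g) (hD : 4 * g ≤ D) (hb : 0 ≤ b)
    (ha : a ≤ 1) (h : b + 1 / g < a) :
    ∃ q : ℚ, q.num.natAbs ≤ D ∧ q.den ≤ D ∧ (q : ℝ) + 1 / (4 * g) ≤ a ∧
      b ≤ (q : ℝ) - 1 / (4 * g) := by
  have hD0 : (0 : ℝ) < D := by linarith
  have hDn : D ≠ 0 := by
    rintro rfl
    simp at hD0
  have hg' : 0 < 1 / g := by positivity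
  have e : 1 / (4 * g) = 1 / g / 4 := by field_simp
  have hprec : 1 / (D : ℝ) ≤ 1 / (4 * g) := one_div_le_one_div_of_le (by linarith) hD
  set T : ℕ := ⌊(a + b) / 2 * D⌋₊ with hT
  have hmid : 0 ≤ (a + b) / 2 * D := mul_nonneg (by linarith) hD0.le
  have h1 : (T : ℝ) ≤ (a + b) / 2 * D := Nat.floor_le hmid
  have h2 : (a + b) / 2 * D < T + 1 := Nat.lt_floor_add_one _
  have h3 : (T / D : ℝ) ≤ (a + b) / 2 := (div_le_iff₀ hD0).2 h1
  have h4 : (a + b) / 2 < T / D + 1 / D := by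
    rw [← add_div, lt_div_iff₀ hD0]
    exact h2
  have hq : (((T : ℚ) / D : ℚ) : ℝ) = T / D := by push_cast; rfl
  have h0 : (0 : ℚ) ≤ (T : ℚ) / D := by positivity
  have hden : ((T : ℚ) / D).den ≤ D := by
    have h5 := Rat.den_dvd (T : ℤ) (D : ℤ)
    rw [Rat.divInt_eq_div, Int.cast_natCast, Int.cast_natCast, Int.natCast_dvd_natCast] at h5
    exact Nat.le_of_dvd (Nat.pos_of_ne_zero hDn) h5
  have hle : (T : ℚ) / D ≤ 1 := by
    have : (T / D : ℝ) ≤ 1 := by linarith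
    rw [← hq] at this
    exact_mod_cast this
  refine ⟨(T : ℚ) / D, (?_ : _ ≤ _).trans hden, hden, ?_, ?_⟩
  · exact (RationalVerifier.natAbs_num_le_den h0).2 hle
  · rw [hq, e]; linarith
  · rw [hq]; linarith

end InteractiveProof

/-! ### The simulations -/

namespace InteractiveProof

open Machine Coded

namespace RationalVerifier

variable {V : RationalVerifier}

/-- With the threshold `1 / 2`, the acceptance probability is about `1 / 4 + u / 2`, where `u` is the
expected payment. This is at least `1 / 4` and at most `3 / 4`, which leaves room for a gap also on
those lengths on which `L` is trivial. -/
theorem exists_isMIP_of_gap {L : Set (List Bool)} {γ : ℕ → ℝ} (hγ : ∀ n, 1 < γ n)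
    {G : Polynomial ℕ} (hG : ∀ n, γ n ≤ (G.eval n : ℕ))
    (hgap : ∀ x y : List Bool, x ∈ L → y ∉ L → x.length = y.length →
      V.value y + 1 / γ x.length < V.value x) :
    ∃ (M : ClassicalVerifier noAdvice) (c e : ℕ → ℝ), M.numProvers = V.numProvers ∧
      (∀ n, 0 ≤ e n ∧ e n + 1 / (4 * γ n) < c n ∧ c n ≤ 1) ∧ M.IsMIP L c e := by
  have hb : Bounded fun n => [unary n, noAdvice n] := ⟨2, fun _ => le_rfl⟩
  have hθ : PolyTimeComputable (fun n => [unary n, noAdvice n]) fun _ => encodeRat (1 / 2) :=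
    Computes.polyTimeComputable (Computes.const [encodeRat (1 / 2)])
  -- At least one coin is needed, so that the bias `1 / 2` is simulated exactly.
  have hm : PolyTimeUnary fun n => (2 * G + 1).eval n :=
    (PolyComp.id.polynomial _).polyTimeUnary
  have hτ : ∀ n, bernoulliProb ((2 * G + 1).eval n) (1 / 2 : ℚ).num.natAbs (1 / 2 : ℚ).den =
      1 / 2 := by
    intro n
    have h1 : (1 / 2 : ℚ).num.natAbs = 1 := by norm_num
    have h2 : (1 / 2 : ℚ).den = 2 := by norm_num
    rw [h1, h2, Polynomial.eval_add, Polynomial.eval_one, bernoulliProb_succ,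
      bernoulliProb_zero_left _ two_pos, bernoulliProb_of_le _ le_rfl]
    norm_num
  have hprec : ∀ n, (1 : ℝ) / 2 ^ (2 * G + 1).eval n ≤ 1 / (2 * γ n) := by
    intro n
    have h1 : (((2 * G + 1).eval n : ℕ) : ℝ) < ((2 ^ (2 * G + 1).eval n : ℕ) : ℝ) := by
      exact_mod_cast Nat.lt_two_pow_self
    have h2 : (((2 * G + 1).eval n : ℕ) : ℝ) = 2 * (G.eval n : ℕ) + 1 := by simp
    have h3 := hγ n
    have h4 := hG n
    rw [h2] at h1
    push_cast at h1
    exact one_div_le_one_div_of_le (by linarith) (by linarith)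
  have hbd := fun x s => acceptProb_withThreshold_bounds V hθ hm x s
    (by norm_num) (by norm_num) (hτ x.length)
  have key : ∀ n, ∃ c e : ℝ, (0 ≤ e ∧ e + 1 / (4 * γ n) < c ∧ c ≤ 1) ∧
      (∀ x ∈ L, x.length = n → ∃ s, c ≤ (V.withThreshold hθ hm).acceptProb x s) ∧
      ∀ x ∉ L, x.length = n → ∀ s, (V.withThreshold hθ hm).acceptProb x s ≤ e := by
    intro n
    have hγn := hγ n
    have hq : 1 / (4 * γ n) < 1 / 4 := one_div_lt_one_div_of_lt (by norm_num) (by linarith)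
    have e1 : 1 / (4 * γ n) = 1 / γ n / 4 := by field_simp
    have e2 : 1 / (2 * γ n) = 1 / γ n / 2 := by field_simp
    have hpos : 0 < 1 / γ n := by positivity
    rcases V.trichotomy L n with hall | hnone | ⟨x, y, hx, hy, hxL, hyL, hmin, hmax⟩
    · refine ⟨1 / 4, 0, ⟨le_rfl, by linarith, by norm_num⟩, fun x _ hx => ?_,
        fun x hxL hx => absurd (hall x hx) hxL⟩
      exact ⟨fun _ _ => [], by linarith [(hbd x fun _ _ => []).2.1]⟩
    · refine ⟨1, 3 / 4, ⟨by norm_num, by linarith, le_rfl⟩,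
        fun x hxL hx => absurd hxL (hnone x hx), fun x _ hx s => ?_⟩
      linarith [(hbd x s).2.2, expectedPayment_le_value (V := V) x s, value_le_one (V := V) x]
    · have h1 := hgap x y hxL hyL (hx.trans hy.symm)
      rw [hx] at h1
      have h2 := hprec n
      have h3 := value_nonneg (V := V) y
      have h4 := value_le_one (V := V) x
      have h5 : (0 : ℝ) ≤ 1 / 2 ^ (2 * G + 1).eval n := by positivity
      refine ⟨(V.value x - 1 / 2 ^ (2 * G + 1).eval n + 1 / 2) / 2, (V.value y + 1 / 2) / 2,
        ⟨by linarith, by linarith, by linarith⟩, fun z hzL hz => ?_, fun z hzL hz s => ?_⟩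
      · obtain ⟨s, hs⟩ := V.exists_isOptimal z
        refine ⟨s, ?_⟩
        have h6 := (hbd z s).1
        have h7 := hmin z hzL hz
        rw [hs.expectedPayment_eq, hz] at h6
        linarith
      · have h6 := (hbd z s).2.2
        have h7 := hmax z hzL hz
        linarith [expectedPayment_le_value (V := V) z s]
  choose c e h1 h2 h3 using key
  exact ⟨V.withThreshold hθ hm, c, e, rfl, h1, fun x hx => h2 _ x hx rfl,
    fun x hx => h3 _ x hx rfl⟩

/-- On every input length there is a threshold with a short code. -/
theorem exists_threshold {L : Set (List Bool)} {γ : ℕ → ℝ} (hγ : ∀ n, 1 < γ n)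
    (hgap : ∀ x y : List Bool, x ∈ L → y ∉ L → x.length = y.length →
      V.value y + 1 / γ x.length < V.value x) (n : ℕ) {D : ℕ} (hD : 4 * γ n ≤ D) :
    ∃ q : ℚ, q.num.natAbs ≤ D ∧ q.den ≤ D ∧
      (∀ x ∈ L, x.length = n → (q : ℝ) + 1 / (4 * γ n) ≤ V.value x) ∧
      ∀ x ∉ L, x.length = n → V.value x ≤ (q : ℝ) - 1 / (4 * γ n) := by
  have hγn := hγ n
  have hD2 : 2 ≤ D := by
    have : (2 : ℝ) ≤ D := by linarith
    exact_mod_cast this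
  have hq : 1 / (4 * γ n) ≤ 1 := by
    rw [div_le_one (by linarith)]
    linarith
  rcases V.trichotomy L n with hall | hnone | ⟨x, y, hx, hy, hxL, hyL, hmin, hmax⟩
  · refine ⟨-1, by simpa using by omega, by simpa using by omega, fun x _ _ => ?_,
      fun x hxL hx => absurd (hall x hx) hxL⟩
    push_cast
    linarith [value_nonneg (V := V) x]
  · refine ⟨2, hD2, le_trans (by norm_num) hD2, fun x hxL hx => absurd hxL (hnone x hx),
      fun x _ _ => ?_⟩
    push_cast
    linarith [value_le_one (V := V) x]
  · have h1 := hgap x y hxL hyL (hx.trans hy.symm)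
    rw [hx] at h1
    obtain ⟨q, h2, h3, h4, h5⟩ := exists_rat_between (by linarith) hD (value_nonneg y)
      (value_le_one x) h1
    exact ⟨q, h2, h3, fun z hzL hz => h4.trans (hmin z hzL hz),
      fun z hzL hz => (hmax z hzL hz).trans h5⟩

end RationalVerifier

end InteractiveProof

theorem mainTheorem5 (L : Set (List Bool)) (V : InteractiveProof.RationalVerifier)
    (hV : V.IsMRIP L) (γ : ℕ → ℝ) (hγ : ∀ n, 1 < γ n)
    (hγpoly : ∃ k : ℕ, Asymptotics.IsBigO Filter.atTop γ (fun n : ℕ => (n : ℝ) ^ k))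
    (hgap : ∀ x y : List Bool, x ∈ L → y ∉ L → x.length = y.length →
      ∀ s s' : InteractiveProof.Profile, V.IsOptimal x s → V.IsOptimal y s' →
        V.expectedPayment y s' + 1 / γ x.length < V.expectedPayment x s) :
    -- a classical protocol with an inverse polynomial gap
    (∃ (M : InteractiveProof.ClassicalVerifier InteractiveProof.noAdvice) (c e : ℕ → ℝ),
      M.numProvers = V.numProvers ∧
      (∀ n, 0 ≤ e n ∧ e n + 1 / (4 * γ n) < c n ∧ c n ≤ 1) ∧ M.IsMIP L c e) ∧
    -- amplification, when a threshold in the gap can be computed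
    (∀ θ : ℕ → ℚ,
      Machine.PolyTimeComputable (fun n : ℕ => [Machine.unary n])
        (fun n => Machine.encodeRat (θ n)) →
      (∀ (x : List Bool) (s : InteractiveProof.Profile), V.IsOptimal x s →
        (x ∈ L → (θ x.length : ℝ) + 1 / (4 * γ x.length) ≤ V.expectedPayment x s) ∧
        (x ∉ L → V.expectedPayment x s ≤ (θ x.length : ℝ) - 1 / (4 * γ x.length))) →
      ∀ q : Polynomial ℕ,
        ∃ M : InteractiveProof.ClassicalVerifier InteractiveProof.noAdvice,
          M.numProvers = V.numProvers ∧
          M.IsMIP L (fun n => 1 - 1 / (((q.eval n : ℕ) : ℝ) + 1)) (fun n => 1 / (((q.eval n : ℕ) : ℝ) + 1))) ∧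
    -- amplification in general, with logarithmically many bits of advice
    (∀ q : Polynomial ℕ, ∃ (adv : ℕ → List Letter) (C : ℕ),
      (∀ n, (adv n).length ≤ C * (Nat.log 2 n + 1)) ∧
      ∃ M : InteractiveProof.ClassicalVerifier adv,
        M.numProvers = V.numProvers ∧
        M.IsMIP L (fun n => 1 - 1 / (((q.eval n : ℕ) : ℝ) + 1))
          (fun n => 1 / (((q.eval n : ℕ) : ℝ) + 1))) := by
  obtain ⟨k, hk⟩ := hγpoly
  obtain ⟨A, hA⟩ := InteractiveProof.exists_polynomial_bound hk
  have hG : ∀ n, γ n ≤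
      ((Polynomial.C A * (Polynomial.X + 1) ^ k : Polynomial ℕ).eval n : ℕ) := by
    simpa using hA
  have hval : ∀ x y : List Bool, x ∈ L → y ∉ L → x.length = y.length →
      V.value y + 1 / γ x.length < V.value x := fun x y hx hy hxy =>
    hgap x y hx hy hxy _ _ (V.exists_isOptimal x).choose_spec (V.exists_isOptimal y).choose_spec
  refine ⟨InteractiveProof.RationalVerifier.exists_isMIP_of_gap hγ hG hval,
    fun θ hθ hsep q => ?_, fun q => ?_⟩
  · have h1 : Machine.Computes (fun n : ℕ => [Machine.unary n, InteractiveProof.noAdvice n])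
        fun n => [Machine.unary n] := Machine.Computes.select (hb := ⟨2, fun _ => le_rfl⟩) [0]
    have h2 := h1.trans (hθ.computes (hb := ⟨1, fun _ => le_rfl⟩))
    exact InteractiveProof.RationalVerifier.exists_isMIP_of_threshold hγ hG h2.polyTimeComputable
      (fun x hx => (hsep x _ (V.exists_isOptimal x).choose_spec).1 hx)
      (fun x hx => (hsep x _ (V.exists_isOptimal x).choose_spec).2 hx) q
  · have hD : ∀ n, 4 * γ n ≤ ((4 * A * (n + 1) ^ k : ℕ) : ℝ) := fun n => by
      have := hA n
      push_cast at this ⊢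
      linarith
    choose θ h1 h2 h3 h4 using fun n =>
      InteractiveProof.RationalVerifier.exists_threshold hγ hval n (hD n)
    refine ⟨fun n => Machine.encodeRat (θ n), 4 + 2 * ((4 * A).size + k), fun n => ?_, ?_⟩
    · have h5 := InteractiveProof.length_encodeRat_le (h1 n) (h2 n)
      have h6 := InteractiveProof.size_mul_pow_le (4 * A) k n
      nlinarith
    · have h5 : Machine.Computes (fun n : ℕ => [Machine.unary n, Machine.encodeRat (θ n)])
          fun n => [Machine.encodeRat (θ n)] :=
        Machine.Computes.select (hb := ⟨2, fun _ => le_rfl⟩) [1]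
      exact InteractiveProof.RationalVerifier.exists_isMIP_of_threshold hγ hG h5.polyTimeComputable
        (fun x hx => h3 _ x hx rfl) (fun x hx => h4 _ x hx rfl) q
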